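/- Let $\psi:\mathbb{N}\to\mathbb{R}$ be a nonnegative function on the positive integers. For each $n\ge 1$ let $$\mathcal{E}_n=\bigcup_{\substack{1\le a\le n\\ \gcd(a,n)=1}}\left(\frac{a-\psi(n)}{n},\frac{a+\psi(n)}{n}\right)\subseteq\mathbb{R}/\mathbb{Z}$$ (each interval being read modulo $1$), and let $W(\psi)=\limsup_{n\to\infty}\mathcal{E}_n=\bigcap_{m\ge1}\bigcup_{n\ge m}\mathcal{E}_n$ be the set of points of $\mathbb{R}/\mathbb{Z}$ that lie in infinitely many of the sets $\mathcal{E}_n$. Let $\varphi$ denote the Euler phi function. If $$\sum_{n=1}^{\infty}\left(\frac{\psi(n)}{n}\right)^{1-\epsilon}\varphi(n)=\infty\qquad\text{for every } 0<\epsilon<1,$$ then $W(\psi)$ has Hausdorff dimension $1$. -/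

import Mathlib

namespace DuffinSchaeffer

/-- The set `ℰ_n ⊆ ℝ/ℤ`: the image in `ℝ/ℤ` of the union, over `1 ≤ a ≤ n` coprime to `n`, of the
open intervals `((a - ψ(n))/n, (a + ψ(n))/n)`. (It is empty for `n = 0`.) -/
def E (ψ : ℕ → ℝ) (n : ℕ) : Set UnitAddCircle :=
  ⋃ a ∈ {a ∈ Finset.Icc 1 n | Nat.Coprime a n},
    (fun x : ℝ => (x : UnitAddCircle)) '' Set.Ioo (((a : ℝ) - ψ n) / n) (((a : ℝ) + ψ n) / n)

/-- `W(ψ) = limsup ℰ_n`: the points of `ℝ/ℤ` lying in infinitely many of the sets `ℰ_n`. -/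
def W (ψ : ℕ → ℝ) : Set UnitAddCircle :=
  Filter.limsup (E ψ) Filter.atTop

end DuffinSchaeffer

namespace DuffinSchaeffer

open Finset MeasureTheory Filter
open scoped ENNReal

/-! The upper bound is free, since the circle is a Lipschitz image of the line. For the lower bound,
each exponent `s < 1` receives a compact set in `[1/4, 1/2]` that projects into `W ψ` and has
nonzero `s`-dimensional Hausdorff measure. It is a decreasing intersection of carriers of step
densities whose mass stays bounded below and whose energy, a weighted sum over dyadic scales of
squared cell masses, stays bounded above.

The building block (`exists_step_density`) spreads mass around the reduced fractions with
denominators in one dyadic block near `N`, giving each fraction `a/n` a weight proportional to `ρ n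
^ t`, with `t` slightly below 1. Divergence makes the normalising constant `A` at least a small
negative power of `N` for infinitely many blocks. At coarse scales the density resembles Lebesgue
measure on `[0, 1]`, by Möbius counting of coprime numerators. At fine scales its energy is
controlled by a pair count: distinct fractions with denominators `n` and `m` within distance `D`
number at most `2Dnm`, so no overlap estimate of Duffin–Schaeffer type is needed. All arithmetic
losses are `N^δ`, hence harmless below dimension 1.

Multiplying a step density `g` by such an `f`, chosen after `g`, hardly changes its mass and coarse
energies, while the new fine energies have a small geometric tail (`exists_refinement`). Iterating
keeps mass and energy under control. A cheap cover of the limit set would, by compactness, cover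
some finite stage, contradicting Cauchy–Schwarz (`integral_sq_le_energy_mul`); no limit measure has
to be constructed. -/

/-! ### Bounds for the divisor function and the totient -/

theorem card_divisors_le_const_mul_rpow {δ : ℝ} (hδ : 0 < δ) :
    ∃ C : ℝ, 1 ≤ C ∧ ∀ n : ℕ, n ≠ 0 → (n.divisors.card : ℝ) ≤ C * (n : ℝ) ^ δ := by
  obtain ⟨P, hP⟩ := exists_nat_ge ((2 : ℝ) ^ (1 / δ))
  have hl : 0 < δ * Real.log 2 := mul_pos hδ (Real.log_pos (by norm_num))
  set c : ℝ := 1 + 1 / (δ * Real.log 2) with hc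
  have hc1 : 1 ≤ c := by rw [hc]; linarith [one_div_pos.2 hl]
  refine ⟨c ^ P, one_le_pow₀ hc1, fun n hn => ?_⟩
  -- Primes with `p ^ δ ≥ 2` lose nothing, since `v + 1 ≤ 2 ^ v`; each prime below `P` loses at most
  -- the factor `c`, and there are at most `P` of them.
  have key : ∀ p ∈ n.primeFactors, ((n.factorization p + 1 : ℕ) : ℝ) ≤
      (if p < P then c else 1) * ((p : ℝ) ^ n.factorization p) ^ δ := by
    intro p hp
    have hp2 : (2 : ℝ) ≤ p := by exact_mod_cast (Nat.prime_of_mem_primeFactors hp).two_le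
    set v := n.factorization p
    have e : ((p : ℝ) ^ v) ^ δ = ((p : ℝ) ^ δ) ^ v := by
      rw [← Real.rpow_natCast, ← Real.rpow_natCast, ← Real.rpow_mul (by positivity),
        ← Real.rpow_mul (by positivity), mul_comm]
    rw [e]
    split_ifs with h
    · have h1 : 1 + v * (δ * Real.log 2) ≤ ((p : ℝ) ^ δ) ^ v := by
        calc 1 + v * (δ * Real.log 2) ≤ Real.exp (v * (δ * Real.log 2)) := by
              linarith [Real.add_one_le_exp (v * (δ * Real.log 2))]
          _ = ((2 : ℝ) ^ δ) ^ v := by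
              rw [Real.rpow_def_of_pos (by norm_num), ← Real.exp_nat_mul]; ring_nf
          _ ≤ _ := by gcongr
      calc ((v + 1 : ℕ) : ℝ) ≤ c * (1 + v * (δ * Real.log 2)) := by
            have : c * (1 + v * (δ * Real.log 2)) =
              1 + v + v * (δ * Real.log 2) + 1 / (δ * Real.log 2) := by
              rw [hc]; field_simp; ring
            rw [this]; push_cast
            have : 0 ≤ (v : ℝ) * (δ * Real.log 2) := by positivity
            linarith [one_div_pos.2 hl]
        _ ≤ _ := by gcongr
    · have h2 : (2 : ℝ) ≤ (p : ℝ) ^ δ := by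
        have : (2 : ℝ) ^ (1 / δ) ≤ p := hP.trans (by exact_mod_cast not_lt.1 h)
        calc (2 : ℝ) = ((2 : ℝ) ^ (1 / δ)) ^ δ := by
              rw [← Real.rpow_mul (by norm_num), one_div_mul_cancel hδ.ne', Real.rpow_one]
          _ ≤ _ := by gcongr
      rw [one_mul]
      calc ((v + 1 : ℕ) : ℝ) ≤ (2 : ℝ) ^ v := by exact_mod_cast Nat.lt_two_pow_self
        _ ≤ _ := by gcongr
  have hnp : (n : ℝ) ^ δ = ∏ p ∈ n.primeFactors, ((p : ℝ) ^ n.factorization p) ^ δ := by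
    rw [Real.finsetProd_rpow _ _ (fun _ _ => by positivity)]
    congr 1
    have := Nat.prod_factorization_pow_eq_self hn
    conv_lhs => rw [← this]
    rw [Finsupp.prod, Nat.support_factorization]; push_cast; rfl
  rw [Nat.card_divisors hn, hnp]
  push_cast
  calc _ ≤ ∏ p ∈ n.primeFactors,
        (if p < P then c else 1) * ((p : ℝ) ^ n.factorization p) ^ δ :=
        prod_le_prod (fun _ _ => by positivity) (fun p hp => by simpa using key p hp)
    _ ≤ _ := by
        rw [prod_mul_distrib]
        gcongr
        rw [prod_ite, prod_const, prod_const_one, mul_one]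
        refine pow_le_pow_right₀ hc1 ?_
        calc _ ≤ (range P).card := card_le_card fun p hp => by simp at hp; simpa using hp.2
          _ = P := card_range P

/-- In `n = ∑ φ(d)` over the divisors of `n`, every term is at most `φ(n)`. -/
theorem le_totient_mul_card_divisors (n : ℕ) : n ≤ n.totient * n.divisors.card := by
  rcases Nat.eq_zero_or_pos n with rfl | hn
  · simp
  conv_lhs => rw [← Nat.sum_totient n]
  rw [mul_comm, ← smul_eq_mul]
  exact sum_le_card_nsmul _ _ _ fun d hd => Nat.le_of_dvd (Nat.totient_pos.2 hn)
    (Nat.totient_dvd_of_dvd (Nat.dvd_of_mem_divisors hd))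

/-! ### Counting coprime integers by Möbius inversion -/

theorem card_coprime_Ioc_eq_sum_moebius {n : ℕ} (hn : n ≠ 0) (K : ℕ) :
    (((Ioc 0 K).filter fun a => Nat.Coprime a n).card : ℤ) =
      ∑ d ∈ n.divisors, ArithmeticFunction.moebius d * ((K / d : ℕ) : ℤ) := by
  have h1 : ∀ a : ℕ, (if Nat.Coprime a n then (1 : ℤ) else 0) =
      ∑ d ∈ n.divisors, if d ∣ a then ArithmeticFunction.moebius d else 0 := by
    intro a
    have hz := congrArg (fun f => f (Nat.gcd a n)) ArithmeticFunction.moebius_mul_coe_zeta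
    simp only [ArithmeticFunction.coe_mul_zeta_apply,
      ArithmeticFunction.one_apply] at hz
    rw [← sum_filter]
    unfold Nat.Coprime
    rw [← hz]
    refine sum_congr ?_ fun _ _ => rfl
    ext d
    simp only [Nat.mem_divisors, mem_filter, Nat.dvd_gcd_iff]
    have : a.gcd n ≠ 0 := by simp [Nat.gcd_eq_zero_iff, hn]
    tauto
  rw [card_filter]
  push_cast
  rw [sum_congr rfl fun a _ => h1 a, sum_comm]
  refine sum_congr rfl fun d _ => ?_
  rw [← sum_filter, sum_const, Nat.Ioc_filter_dvd_card_eq_div, nsmul_eq_mul, mul_comm,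
    Int.natCast_div]

/-- Removing the floors in the Möbius sum costs at most 1 per divisor. -/
theorem abs_card_coprime_sub_le {n : ℕ} (hn : n ≠ 0) {y : ℝ} (hy : 0 ≤ y) :
    |(((Ioc 0 ⌊y⌋₊).filter fun a => Nat.Coprime a n).card : ℝ) - y * n.totient / n| ≤
      n.divisors.card := by
  have h1 : (((Ioc 0 ⌊y⌋₊).filter fun a => Nat.Coprime a n).card : ℝ) =
      ∑ d ∈ n.divisors, (ArithmeticFunction.moebius d : ℝ) * ((⌊y⌋₊ / d : ℕ) : ℝ) := by
    simpa only [Int.cast_natCast, Int.cast_sum, Int.cast_mul] using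
      congrArg (Int.cast (R := ℝ)) (card_coprime_Ioc_eq_sum_moebius hn ⌊y⌋₊)
  have htot : ((Ioc 0 n).filter fun a => Nat.Coprime a n).card = n.totient := by
    rw [← Nat.filter_coprime_Ico_eq_totient n 1]
    congr 1
    ext a
    simp [Nat.coprime_comm, Nat.succ_le_iff, add_comm 1 n]
  have h2 : (n.totient : ℝ) =
      ∑ d ∈ n.divisors, (ArithmeticFunction.moebius d : ℝ) * ((n : ℝ) / d) := by
    have := congrArg (Int.cast (R := ℝ)) (card_coprime_Ioc_eq_sum_moebius hn n)
    rw [htot] at this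
    simp only [Int.cast_natCast, Int.cast_sum, Int.cast_mul] at this
    rw [this]
    refine sum_congr rfl fun d hd => ?_
    rw [Nat.cast_div (Nat.dvd_of_mem_divisors hd)
      (Nat.cast_ne_zero.2 (Nat.pos_of_mem_divisors hd).ne')]
  have hn' : (n : ℝ) ≠ 0 := by exact_mod_cast hn
  have h3 : y * n.totient / n =
      ∑ d ∈ n.divisors, (ArithmeticFunction.moebius d : ℝ) * (y / d) := by
    rw [h2, mul_sum, sum_div]
    refine sum_congr rfl fun d hd => ?_
    field_simp
  rw [h1, h3, ← sum_sub_distrib]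
  refine (abs_sum_le_sum_abs _ _).trans ?_
  calc _ ≤ ∑ d ∈ n.divisors, (1 : ℝ) := ?_
    _ = _ := by simp
  refine sum_le_sum fun d hd => ?_
  rw [← mul_sub, abs_mul]
  have hm : |(ArithmeticFunction.moebius d : ℝ)| ≤ 1 := by
    exact_mod_cast ArithmeticFunction.abs_moebius_le_one (n := d)
  have hf : |((⌊y⌋₊ / d : ℕ) : ℝ) - y / d| ≤ 1 := by
    rw [← Nat.floor_div_natCast, abs_le]
    have := Nat.floor_le (a := y / d) (by positivity)
    have := Nat.lt_floor_add_one (y / d)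
    constructor <;> linarith
  calc _ ≤ (1 : ℝ) * 1 := by gcongr
    _ = 1 := one_mul 1

/-! ### Counting pairs of close fractions -/

/-- Two solutions have first coordinates congruent modulo `n' = n / gcd n m`, so they lie in
different blocks of length `n'`, of which `[1, n]` contains `gcd n m`. -/
theorem card_pairs_eq_le {n m : ℕ} (hn : 0 < n) (c : ℤ) :
    (((Icc 1 n ×ˢ Icc 1 m).filter
      fun x : ℕ × ℕ => (x.1 : ℤ) * m - x.2 * n = c).card) ≤ Nat.gcd n m := by
  set g := Nat.gcd n m
  have hg : 0 < g := Nat.gcd_pos_of_pos_left _ hn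
  obtain ⟨n', hn'⟩ : g ∣ n := Nat.gcd_dvd_left n m
  obtain ⟨m', hm'⟩ : g ∣ m := Nat.gcd_dvd_right n m
  have hn0 : 0 < n' := Nat.pos_of_ne_zero (by rintro rfl; simp at hn'; omega)
  have hcop : Nat.Coprime n' m' := by
    have : Nat.gcd (g * n') (g * m') = g := by rw [← hn', ← hm']
    rw [Nat.gcd_mul_left] at this
    exact Nat.eq_of_mul_eq_mul_left hg (by simpa using this)
  rw [← card_range g]
  refine card_le_card_of_injOn (fun x => (x.1 - 1) / n') ?_ ?_
  · intro x hx
    simp only [coe_filter, mem_product, mem_Icc, Set.mem_ofPred_eq] at hx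
    simp only [coe_range, Set.mem_Iio]
    rw [Nat.div_lt_iff_lt_mul hn0, ← hn']
    omega
  · intro x hx y hy hxy
    simp only [coe_filter, mem_product, mem_Icc, Set.mem_ofPred_eq] at hx hy
    simp only at hxy
    obtain ⟨⟨⟨hx1, hx2⟩, hx3, hx4⟩, hx5⟩ := hx
    obtain ⟨⟨⟨hy1, hy2⟩, hy3, hy4⟩, hy5⟩ := hy
    have e1 : ((x.1 : ℤ) - y.1) * m' = (x.2 - y.2) * n' := by
      have : (g : ℤ) * (((x.1 : ℤ) - y.1) * m') = g * ((x.2 - y.2) * n') := by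
        have a1 : (n : ℤ) = g * n' := by exact_mod_cast hn'
        have a2 : (m : ℤ) = g * m' := by exact_mod_cast hm'
        rw [a1, a2] at hx5 hy5
        linear_combination hx5 - hy5
      exact mul_left_cancel₀ (by exact_mod_cast hg.ne') this
    have hd : (n' : ℤ) ∣ (x.1 : ℤ) - y.1 := by
      have : (n' : ℤ) ∣ ((x.1 : ℤ) - y.1) * m' := ⟨_, by rw [e1, mul_comm]⟩
      exact (Nat.isCoprime_iff_coprime.2 hcop).dvd_of_dvd_mul_right this
    have e2 : x.1 = y.1 := by
      have q1 := Nat.div_add_mod (x.1 - 1) n'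
      have q2 := Nat.div_add_mod (y.1 - 1) n'
      have r1 := Nat.mod_lt (x.1 - 1) hn0
      have r2 := Nat.mod_lt (y.1 - 1) hn0
      rw [hxy] at q1
      have : |(x.1 : ℤ) - y.1| < n' := by rw [abs_lt]; constructor <;> omega
      have := Int.eq_zero_of_abs_lt_dvd hd this
      omega
    have e3 : x.2 = y.2 := by
      rw [e2] at e1
      simp only [sub_self, zero_mul] at e1
      have := (mul_eq_zero.1 e1.symm).resolve_right (by exact_mod_cast hn0.ne')
      omega
    exact Prod.ext e2 e3

/-- Excluding zero removes the usual `+ 1`, so the bound remains linear in `B` however small `B` is.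
-/
theorem card_nonzero_multiples_le {g : ℕ} (hg : 0 < g) {B : ℝ} (hB : 0 ≤ B) (T : Finset ℤ)
    (hT : ∀ c ∈ T, c ≠ 0 ∧ (g : ℤ) ∣ c ∧ |(c : ℝ)| ≤ B) : (T.card : ℝ) * g ≤ 2 * B := by
  have hg' : (0 : ℝ) < g := by exact_mod_cast hg
  have hsub : T.image (fun c => c / (g : ℤ)) ⊆
      (Icc (-⌊B / g⌋) ⌊B / g⌋).erase 0 := by
    intro k hk
    obtain ⟨c, hc, rfl⟩ := mem_image.1 hk
    obtain ⟨h0, ⟨k, rfl⟩, hB⟩ := hT c hc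
    rw [Int.mul_ediv_cancel_left _ (by exact_mod_cast hg.ne')]
    have hk0 : k ≠ 0 := by rintro rfl; simp at h0
    have hk : |(k : ℝ)| ≤ B / g := by
      rw [le_div_iff₀ hg', mul_comm]
      push_cast at hB
      rwa [abs_mul, abs_of_pos hg'] at hB
    rw [abs_le] at hk
    simp only [mem_erase, mem_Icc, ne_eq, hk0, not_false_eq_true, true_and]
    refine ⟨?_, Int.le_floor.2 hk.2⟩
    have : -k ≤ ⌊B / g⌋ := Int.le_floor.2 (by push_cast; linarith [hk.1])
    linarith
  have hcard : T.card ≤ ((Icc (-⌊B / g⌋) ⌊B / g⌋).erase 0).card := by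
    rw [← card_image_of_injOn (s := T) (f := fun c => c / (g : ℤ))]
    · exact card_le_card hsub
    · intro a ha b hb hab
      exact (Int.ediv_left_inj (hT a ha).2.1 (hT b hb).2.1).1 hab
  have hfl : 0 ≤ ⌊B / g⌋ := Int.floor_nonneg.2 (by positivity)
  rw [card_erase_of_mem (by simp [hfl]), Int.card_Icc] at hcard
  have : (T.card : ℤ) ≤ 2 * ⌊B / g⌋ := by omega
  have h2 : (T.card : ℝ) ≤ 2 * (B / g) := by
    calc (T.card : ℝ) ≤ 2 * (⌊B / g⌋ : ℝ) := by exact_mod_cast this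
      _ ≤ _ := by gcongr; exact Int.floor_le _
  calc _ ≤ 2 * (B / g) * g := by gcongr
    _ = 2 * B := by field_simp

/-- The numerator `a m - b n` of the difference is a nonzero multiple of the gcd of size at most `D
n m`. The gcd saved in counting its values pays for the multiplicity of each value. -/
theorem card_pairs_close_le {n m : ℕ} (hn : 0 < n) (hm : 0 < m) {D : ℝ} (hD : 0 ≤ D) :
    (((Icc 1 n ×ˢ Icc 1 m).filter fun x : ℕ × ℕ =>
      (x.1 : ℝ) / n ≠ x.2 / m ∧ |(x.1 : ℝ) / n - x.2 / m| ≤ D).card : ℝ) ≤ 2 * (D * n * m) := by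
  set P := (Icc 1 n ×ˢ Icc 1 m).filter fun x : ℕ × ℕ =>
      (x.1 : ℝ) / n ≠ x.2 / m ∧ |(x.1 : ℝ) / n - x.2 / m| ≤ D
  set F : ℕ × ℕ → ℤ := fun x => (x.1 : ℤ) * m - x.2 * n
  have hg : 0 < Nat.gcd n m := Nat.gcd_pos_of_pos_left _ hn
  have hn' : (0 : ℝ) < n := by exact_mod_cast hn
  have hm' : (0 : ℝ) < m := by exact_mod_cast hm
  have h1 : P.card ≤ Nat.gcd n m * (P.image F).card := by
    refine card_le_mul_card_image P _ fun c _ => ?_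
    refine le_trans (card_le_card ?_) (card_pairs_eq_le hn c)
    intro x hx
    simp only [mem_filter, P, F] at hx ⊢
    exact ⟨hx.1.1, hx.2⟩
  have h2 : ((P.image F).card : ℝ) * (Nat.gcd n m : ℕ) ≤ 2 * (D * n * m) := by
    refine card_nonzero_multiples_le hg (by positivity) _ fun c hc => ?_
    obtain ⟨x, hx, rfl⟩ := mem_image.1 hc
    simp only [mem_filter, P] at hx
    obtain ⟨_, hx1, hx2⟩ := hx
    have e : ((F x : ℤ) : ℝ) = ((x.1 : ℝ) / n - x.2 / m) * (n * m) := by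
      simp only [F]; push_cast; field_simp
    refine ⟨?_, ?_, ?_⟩
    · intro h0
      rw [h0] at e
      have : (x.1 : ℝ) / n - x.2 / m = 0 := by
        have h3 : (n : ℝ) * m ≠ 0 := by positivity
        exact (mul_eq_zero.1 (by simpa using e.symm)).resolve_right h3
      exact hx1 (sub_eq_zero.1 this)
    · exact dvd_sub (Dvd.dvd.mul_left (by exact_mod_cast Nat.gcd_dvd_right n m) _)
        (Dvd.dvd.mul_left (by exact_mod_cast Nat.gcd_dvd_left n m) _)
    · rw [e, abs_mul, abs_of_pos (show (0 : ℝ) < n * m by positivity), mul_assoc]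
      gcongr
  calc (P.card : ℝ) ≤ (Nat.gcd n m : ℕ) * ((P.image F).card : ℝ) := by exact_mod_cast h1
    _ ≤ _ := by rw [mul_comm]; exact h2

theorem fraction_eq_iff {n m a b : ℕ} (hn : 0 < n) (hm : 0 < m) (ha : Nat.Coprime a n)
    (hb : Nat.Coprime b m) (h : (a : ℝ) / n = b / m) : n = m ∧ a = b := by
  have hn' : (n : ℝ) ≠ 0 := by exact_mod_cast hn.ne'
  have hm' : (m : ℝ) ≠ 0 := by exact_mod_cast hm.ne'
  rw [div_eq_div_iff hn' hm'] at h
  have h' : a * m = b * n := by exact_mod_cast h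
  have h1 : n ∣ m := ha.symm.dvd_of_dvd_mul_left ⟨b, by rw [h', mul_comm]⟩
  have h2 : m ∣ n := hb.symm.dvd_of_dvd_mul_left ⟨a, by rw [← h', mul_comm]⟩
  have e := Nat.dvd_antisymm h1 h2
  subst e
  exact ⟨rfl, Nat.eq_of_mul_eq_mul_right hn h'⟩

/-! ### Cells and uniform bumps -/

/-- The open interval `(i h, (i + 2) h)`. As `i` varies, these cover the line with multiplicity at
most two, and every bounded set of diameter less than `h` lies in one of them. -/
def cell (h : ℝ) (i : ℤ) : Set ℝ := Set.Ioo (i * h) ((i + 2) * h)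

theorem measurableSet_cell (h : ℝ) (i : ℤ) : MeasurableSet (cell h i) := measurableSet_Ioo

theorem card_filter_mem_cell_le {h : ℝ} (hh : 0 < h) (s : Finset ℤ) (x : ℝ)
    [DecidablePred fun i => x ∈ cell h i] : (s.filter fun i => x ∈ cell h i).card ≤ 2 := by
  calc _ ≤ (Icc (⌈x / h⌉ - 2) (⌈x / h⌉ - 1)).card := by
        refine card_le_card fun i hi => ?_
        simp only [cell, mem_filter, Set.mem_Ioo] at hi
        have h1 : (i : ℝ) < x / h := by rw [lt_div_iff₀ hh]; exact hi.2.1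
        have h2 : x / h < (i : ℝ) + 2 := by rw [div_lt_iff₀ hh]; exact hi.2.2
        have h3 : i < ⌈x / h⌉ := Int.lt_ceil.2 h1
        have h4 : ⌈x / h⌉ ≤ i + 2 := Int.ceil_le.2 (by push_cast; exact h2.le)
        rw [mem_Icc]; omega
    _ = 2 := by rw [Int.card_Icc]; omega

theorem sum_setIntegral_cell_le {h : ℝ} (hh : 0 < h) {g : ℝ → ℝ} (hg : Integrable g)
    (hg0 : ∀ x, 0 ≤ g x) (s : Finset ℤ) : ∑ i ∈ s, ∫ x in cell h i, g x ≤ 2 * ∫ x, g x := by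
  classical
  simp_rw [← integral_indicator (measurableSet_cell h _)]
  rw [← integral_finsetSum _ fun i _ => hg.indicator (measurableSet_cell h i),
    ← integral_const_mul]
  refine integral_mono (integrable_finsetSum _ fun i _ => hg.indicator (measurableSet_cell h i))
    (hg.const_mul 2) fun x => ?_
  simp only [Set.indicator_apply]
  rw [← sum_filter, sum_const, nsmul_eq_mul]
  gcongr
  · exact hg0 x
  · exact_mod_cast card_filter_mem_cell_le hh s x

/-- The density of the uniform probability measure on `[c - ρ, c + ρ]`. -/
noncomputable def bump (c ρ : ℝ) : ℝ → ℝ :=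
  (Set.Icc (c - ρ) (c + ρ)).indicator fun _ => (2 * ρ)⁻¹

theorem bump_nonneg {c ρ : ℝ} (hρ : 0 < ρ) (x : ℝ) : 0 ≤ bump c ρ x :=
  Set.indicator_nonneg (fun _ _ => by positivity) x

theorem integrable_bump (c ρ : ℝ) : Integrable (bump c ρ) := by
  unfold bump
  rw [integrable_indicator_iff measurableSet_Icc]
  exact integrableOn_const (by simp)

theorem integral_bump {c ρ : ℝ} (hρ : 0 < ρ) : ∫ x, bump c ρ x = 1 := by
  unfold bump
  rw [integral_indicator measurableSet_Icc, setIntegral_const,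
    Real.volume_real_Icc_of_le (by linarith), smul_eq_mul]
  field_simp
  ring

theorem setIntegral_bump_nonneg {c ρ : ℝ} (hρ : 0 < ρ) (s : Set ℝ) :
    0 ≤ ∫ x in s, bump c ρ x :=
  integral_nonneg fun x => bump_nonneg hρ x

theorem setIntegral_bump_le_one {c ρ : ℝ} (hρ : 0 < ρ) (s : Set ℝ) :
    ∫ x in s, bump c ρ x ≤ 1 := by
  rw [← integral_bump (c := c) hρ]
  exact setIntegral_le_integral (integrable_bump c ρ) (ae_of_all _ (bump_nonneg hρ))

theorem setIntegral_bump_eq_zero {c ρ : ℝ} {s : Set ℝ}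
    (h : ∀ x ∈ s, x ∉ Set.Icc (c - ρ) (c + ρ)) : ∫ x in s, bump c ρ x = 0 :=
  setIntegral_eq_zero_of_forall_eq_zero fun x hx => Set.indicator_of_notMem (h x hx) _

theorem setIntegral_cell_bump_le {c ρ h : ℝ} (hρ : 0 < ρ) (hh : 0 < h) (i : ℤ) :
    ∫ x in cell h i, bump c ρ x ≤ min 1 (h / ρ) := by
  refine le_min (setIntegral_bump_le_one hρ _) ?_
  calc ∫ x in cell h i, bump c ρ x ≤ ∫ x in cell h i, (2 * ρ)⁻¹ := by
        refine integral_mono (integrable_bump c ρ).integrableOn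
          (integrableOn_const (by simp [cell])) fun x => ?_
        exact Set.indicator_le_self' (fun _ _ => by positivity) x
    _ = h / ρ := by
        rw [setIntegral_const, cell, Real.volume_real_Ioo_of_le (by nlinarith), smul_eq_mul]
        field_simp
        ring

/-- The wider bump is bounded uniformly on each cell; the other has total cell mass at most 2. -/
theorem sum_cell_bump_mul_bump_le {c c' ρ ρ' h : ℝ} (hρ : 0 < ρ) (hρ' : 0 < ρ') (hh : 0 < h)
    (s : Finset ℤ) :
    ∑ i ∈ s, (∫ x in cell h i, bump c ρ x) * ∫ x in cell h i, bump c' ρ' x ≤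
      2 * min 1 (h / max ρ ρ') := by
  have main : ∀ {c c' ρ ρ' : ℝ}, 0 < ρ → 0 < ρ' →
      ∑ i ∈ s, (∫ x in cell h i, bump c ρ x) * ∫ x in cell h i, bump c' ρ' x ≤
        2 * min 1 (h / ρ) := by
    intro c c' ρ ρ' hρ hρ'
    calc _ ≤ ∑ i ∈ s, min 1 (h / ρ) * ∫ x in cell h i, bump c' ρ' x :=
          sum_le_sum fun i _ => mul_le_mul_of_nonneg_right (setIntegral_cell_bump_le hρ hh i)
            (setIntegral_bump_nonneg hρ' _)
      _ = min 1 (h / ρ) * ∑ i ∈ s, ∫ x in cell h i, bump c' ρ' x := by rw [mul_sum]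
      _ ≤ min 1 (h / ρ) * (2 * 1) := by
          gcongr
          rw [← integral_bump (c := c') hρ']
          exact sum_setIntegral_cell_le hh (integrable_bump c' ρ') (bump_nonneg hρ') s
      _ = _ := by ring
  rcases le_total ρ ρ' with hle | hle
  · rw [max_eq_right hle, sum_congr rfl fun i _ => mul_comm _ _]
    exact main hρ' hρ
  · rw [max_eq_left hle]
    exact main hρ hρ'

theorem sum_cell_bump_mul_bump_eq_zero {c c' ρ ρ' h : ℝ} (hfar : 2 * h + ρ + ρ' < |c - c'|)
    (s : Finset ℤ) :
    ∑ i ∈ s, (∫ x in cell h i, bump c ρ x) * ∫ x in cell h i, bump c' ρ' x = 0 := by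
  refine sum_eq_zero fun i _ => ?_
  by_cases h1 : ∀ x ∈ cell h i, x ∉ Set.Icc (c - ρ) (c + ρ)
  · rw [setIntegral_bump_eq_zero h1, zero_mul]
  · rw [setIntegral_bump_eq_zero (c := c'), mul_zero]
    push Not at h1
    obtain ⟨x, hx, hx1, hx2⟩ := h1
    rintro y hy ⟨hy1, hy2⟩
    simp only [cell, Set.mem_Ioo] at hx hy
    rcases abs_cases (c - c') with h3 | h3 <;> nlinarith

/-! ### Energy of a mixture of bumps around reduced fractions -/

/-- The numerators `1 ≤ a ≤ n` coprime to `n`. -/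
def numerators (n : ℕ) : Finset ℕ := (Ioc 0 n).filter fun a => Nat.Coprime a n

theorem card_numerators (n : ℕ) : (numerators n).card = n.totient := by
  rw [← Nat.filter_coprime_Ico_eq_totient n 1]
  congr 1
  ext a
  simp [numerators, Nat.coprime_comm, Nat.succ_le_iff, add_comm 1 n]

/-- The number of interacting pairs grows like `h + R` and their interaction decays like `min 1 (h /
R)`; the product is of order `h`, whatever the radii. -/
theorem min_one_div_mul_add_le {h R : ℝ} (hh : 0 < h) (hR : 0 < R) :
    min 1 (h / R) * (h + R) ≤ 2 * h := by
  rcases le_total h R with hle | hle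
  · calc _ ≤ h / R * (2 * R) := by
          gcongr
          · exact min_le_right _ _
          · linarith
      _ = 2 * h := by field_simp
  · calc _ ≤ 1 * (2 * h) := by
          gcongr
          · exact min_le_left _ _
          · linarith
      _ = 2 * h := by ring

/-- Pairs farther apart than `D` share no cell, close distinct pairs are counted by
`card_pairs_close_le`, and reduced fractions coincide only on the diagonal. -/
theorem sum_numerators_bump_mul_bump_le {ρ : ℕ → ℝ} {n m : ℕ} (hn : 0 < n) (hm : 0 < m)
    (hρn : 0 < ρ n) (hρm : 0 < ρ m) {h : ℝ} (hh : 0 < h) (s : Finset ℤ) :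
    ∑ a ∈ numerators n, ∑ b ∈ numerators m, ∑ i ∈ s,
      (∫ x in cell h i, bump ((a : ℝ) / n) (ρ n) x) *
        ∫ x in cell h i, bump ((b : ℝ) / m) (ρ m) x ≤
      16 * (h * n * m) + if n = m then 2 * (n.totient * min 1 (h / ρ n)) else 0 := by
  classical
  set P : ℕ → ℕ → ℝ := fun a b => ∑ i ∈ s,
      (∫ x in cell h i, bump ((a : ℝ) / n) (ρ n) x) *
        ∫ x in cell h i, bump ((b : ℝ) / m) (ρ m) x with hP
  set R := max (ρ n) (ρ m) with hR
  have hR0 : 0 < R := lt_max_of_lt_left hρn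
  set D := 2 * h + ρ n + ρ m with hD
  set T := (Icc 1 n ×ˢ Icc 1 m).filter fun x : ℕ × ℕ =>
      (x.1 : ℝ) / n ≠ x.2 / m ∧ |(x.1 : ℝ) / n - x.2 / m| ≤ D
  have hmem : ∀ {k a : ℕ}, a ∈ numerators k → a ∈ Icc 1 k ∧ Nat.Coprime a k := by
    intro k a ha
    simp only [numerators, mem_filter, mem_Ioc] at ha
    exact ⟨mem_Icc.2 ha.1, ha.2⟩
  have hP1 : ∀ a b, P a b ≤ 2 * min 1 (h / R) := fun a b => sum_cell_bump_mul_bump_le hρn hρm hh s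
  have hpt : ∀ x ∈ numerators n ×ˢ numerators m, P x.1 x.2 ≤
      (if x ∈ T then 2 * min 1 (h / R) else 0) +
        if n = m ∧ x.1 = x.2 then 2 * min 1 (h / ρ n) else 0 := by
    intro x hx
    obtain ⟨hx1, hx2⟩ := mem_product.1 hx
    obtain ⟨hx1, hc1⟩ := hmem hx1
    obtain ⟨hx2, hc2⟩ := hmem hx2
    by_cases heq : (x.1 : ℝ) / n = x.2 / m
    · have hE := fraction_eq_iff hn hm hc1 hc2 heq
      rw [if_pos hE]
      refine le_add_of_nonneg_of_le (by split_ifs <;> positivity) ?_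
      refine (hP1 _ _).trans ?_
      rw [hR, hE.1, max_self]
    · refine le_add_of_le_of_nonneg ?_ (by split_ifs <;> positivity)
      by_cases hfar : |(x.1 : ℝ) / n - x.2 / m| ≤ D
      · rw [if_pos (mem_filter.2 ⟨mem_product.2 ⟨hx1, hx2⟩, heq, hfar⟩)]
        exact hP1 _ _
      · rw [show P x.1 x.2 = 0 from sum_cell_bump_mul_bump_eq_zero (not_le.1 hfar) s]
        split_ifs <;> positivity
  rw [← sum_product' _ _ P]
  refine (sum_le_sum hpt).trans ?_
  rw [sum_add_distrib]
  gcongr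
  · rw [← sum_filter, sum_const, nsmul_eq_mul]
    have hcard : ((((numerators n ×ˢ numerators m).filter fun x => x ∈ T).card : ℕ) : ℝ) ≤
        2 * (D * n * m) := by
      refine le_trans ?_ (card_pairs_close_le hn hm (D := D) (by positivity))
      exact_mod_cast card_le_card fun x hx => (mem_filter.1 hx).2
    have hDR : D ≤ 2 * (h + R) := by
      rw [hD, hR]; linarith [le_max_left (ρ n) (ρ m), le_max_right (ρ n) (ρ m)]
    calc _ ≤ 2 * (2 * (h + R) * n * m) * (2 * min 1 (h / R)) := by
          gcongr
          exact hcard.trans (by gcongr)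
      _ = 8 * (min 1 (h / R) * (h + R)) * (n * m) := by ring
      _ ≤ 8 * (2 * h) * (n * m) := by
          have := min_one_div_mul_add_le hh hR0
          exact mul_le_mul_of_nonneg_right (by linarith) (by positivity)
      _ = _ := by ring
  · by_cases hnm : n = m
    · subst hnm
      rw [if_pos rfl, sum_product]
      simp only [true_and, sum_ite_eq]
      rw [sum_congr rfl fun a ha => if_pos ha, sum_const, card_numerators, nsmul_eq_mul]
      linarith
    · simp [hnm]

/-- The mixture, with weights `w n`, of the uniform distributions on the intervals of radius `ρ n`
around the reduced fractions with denominator `n ∈ S`. -/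
noncomputable def fractionDensity (S : Finset ℕ) (w ρ : ℕ → ℝ) (x : ℝ) : ℝ :=
  ∑ n ∈ S, w n * ∑ a ∈ numerators n, bump ((a : ℝ) / n) (ρ n) x

theorem setIntegral_fractionDensity (S : Finset ℕ) (w ρ : ℕ → ℝ) (s : Set ℝ) :
    ∫ x in s, fractionDensity S w ρ x =
      ∑ n ∈ S, w n * ∑ a ∈ numerators n, ∫ x in s, bump ((a : ℝ) / n) (ρ n) x := by
  unfold fractionDensity
  have hi : ∀ c r : ℝ, Integrable (bump c r) (volume.restrict s) :=
    fun c r => (integrable_bump c r).integrableOn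
  rw [integral_finsetSum _ fun n _ => (integrable_finsetSum _ fun a _ => hi _ _).const_mul _]
  refine sum_congr rfl fun n _ => ?_
  rw [integral_const_mul, integral_finsetSum _ fun a _ => hi _ _]

theorem integrable_fractionDensity (S : Finset ℕ) (w ρ : ℕ → ℝ) :
    Integrable (fractionDensity S w ρ) :=
  integrable_finsetSum _ fun _ _ =>
    (integrable_finsetSum _ fun _ _ => integrable_bump _ _).const_mul _

theorem fractionDensity_nonneg {S : Finset ℕ} {w ρ : ℕ → ℝ} (hw : ∀ n ∈ S, 0 ≤ w n)
    (hρ : ∀ n ∈ S, 0 < ρ n) (x : ℝ) : 0 ≤ fractionDensity S w ρ x :=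
  sum_nonneg fun n hn => mul_nonneg (hw n hn) (sum_nonneg fun _ _ => bump_nonneg (hρ n hn) x)

theorem integral_fractionDensity {S : Finset ℕ} {w ρ : ℕ → ℝ} (hρ : ∀ n ∈ S, 0 < ρ n) :
    ∫ x, fractionDensity S w ρ x = ∑ n ∈ S, w n * n.totient := by
  rw [← setIntegral_univ, setIntegral_fractionDensity]
  refine sum_congr rfl fun n hn => ?_
  simp only [setIntegral_univ]
  rw [sum_congr rfl fun a _ => integral_bump (hρ n hn), sum_const, card_numerators]
  simp

theorem sum_cell_fractionDensity_sq_le {S : Finset ℕ} {w ρ : ℕ → ℝ} (hS : ∀ n ∈ S, 0 < n)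
    (hw : ∀ n ∈ S, 0 ≤ w n) (hρ : ∀ n ∈ S, 0 < ρ n) {h : ℝ} (hh : 0 < h) (s : Finset ℤ) :
    ∑ i ∈ s, (∫ x in cell h i, fractionDensity S w ρ x) ^ 2 ≤
      16 * h * (∑ n ∈ S, w n * n) ^ 2 +
        2 * ∑ n ∈ S, w n ^ 2 * (n.totient * min 1 (h / ρ n)) := by
  calc _ = ∑ n ∈ S, ∑ m ∈ S, w n * w m * ∑ a ∈ numerators n, ∑ b ∈ numerators m, ∑ i ∈ s,
      (∫ x in cell h i, bump ((a : ℝ) / n) (ρ n) x) *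
        ∫ x in cell h i, bump ((b : ℝ) / m) (ρ m) x := by
        simp_rw [setIntegral_fractionDensity, sq, sum_mul_sum]
        rw [sum_comm]
        refine sum_congr rfl fun n _ => ?_
        rw [sum_comm]
        refine sum_congr rfl fun m _ => ?_
        rw [sum_congr rfl fun i _ => mul_mul_mul_comm _ _ _ _, ← mul_sum]
        congr 1
        simp_rw [sum_mul_sum]
        rw [sum_comm]
        refine sum_congr rfl fun a _ => ?_
        rw [sum_comm]
    _ ≤ ∑ n ∈ S, ∑ m ∈ S, w n * w m * (16 * (h * n * m) +
        if n = m then 2 * (n.totient * min 1 (h / ρ n)) else 0) := by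
        refine sum_le_sum fun n hn => sum_le_sum fun m hm => ?_
        exact mul_le_mul_of_nonneg_left (sum_numerators_bump_mul_bump_le (hS n hn) (hS m hm)
          (hρ n hn) (hρ m hm) hh s) (mul_nonneg (hw n hn) (hw m hm))
    _ = _ := by
        simp_rw [mul_add, sum_add_distrib]
        congr 1
        · rw [sq, sum_mul_sum, mul_sum]
          refine sum_congr rfl fun n _ => ?_
          rw [mul_sum]
          exact sum_congr rfl fun m _ => by ring
        · rw [mul_sum]
          refine sum_congr rfl fun n hn => ?_
          simp only [mul_ite, mul_zero]
          rw [sum_ite_eq, if_pos hn]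
          ring

/-! ### Equidistribution at coarse scales and choice of a dyadic block -/

/-- As `ρ ≤ 1 / n`, bumps with `a ≤ y n - 1` lie wholly left of `y` and those with `a > y n + 1`
wholly right. The shift by 1 costs `φ(n) / n ≤ 1` beyond the Möbius error. -/
theorem sum_numerators_setIntegral_Iic_bump {n : ℕ} (hn : 0 < n) {ρ : ℝ} (hρ : 0 < ρ)
    (hρn : ρ ≤ 1 / n) {y : ℝ} (hy0 : 0 ≤ y) (hy1 : y ≤ 1) :
    |(∑ a ∈ numerators n, ∫ x in Set.Iic y, bump ((a : ℝ) / n) ρ x) - y * n.totient| ≤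
      n.divisors.card + 1 := by
  have hn' : (0 : ℝ) < n := by exact_mod_cast hn
  have htot : (n.totient : ℝ) ≤ n := by exact_mod_cast Nat.totient_le n
  have hq : (n.totient : ℝ) / n ≤ 1 := (div_le_one hn').2 htot
  have hρn' : ρ * n ≤ 1 := by rwa [le_div_iff₀ hn'] at hρn
  have hcard : ∀ (z : ℝ) (p : ℕ → Prop) [DecidablePred p],
      (∀ a ∈ numerators n, p a → (a : ℝ) ≤ z) →
      (((numerators n).filter p).card : ℝ) ≤
        (((Ioc 0 ⌊z⌋₊).filter fun a => Nat.Coprime a n).card : ℝ) := by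
    intro z p _ hp
    refine Nat.cast_le.2 (card_le_card fun a ha => ?_)
    obtain ⟨ha, hpa⟩ := mem_filter.1 ha
    have haz := hp a ha hpa
    simp only [numerators, mem_filter, mem_Ioc] at ha ⊢
    exact ⟨⟨ha.1.1, Nat.le_floor haz⟩, ha.2⟩
  rw [abs_le]
  constructor
  · rcases lt_or_ge (y * n) 1 with hlt | hge
    · have h1 : y * n.totient ≤ 1 := (mul_le_mul_of_nonneg_left htot hy0).trans hlt.le
      have h2 : 0 ≤ ∑ a ∈ numerators n, ∫ x in Set.Iic y, bump ((a : ℝ) / n) ρ x :=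
        sum_nonneg fun _ _ => setIntegral_bump_nonneg hρ _
      have h3 : (0 : ℝ) ≤ n.divisors.card := by positivity
      linarith
    · set z := y * n - 1 with hz
      have hz0 : 0 ≤ z := by linarith
      have hsub : ((Ioc 0 ⌊z⌋₊).filter fun a => Nat.Coprime a n) ⊆ numerators n := by
        intro a ha
        simp only [numerators, mem_filter, mem_Ioc] at ha ⊢
        refine ⟨⟨ha.1.1, ?_⟩, ha.2⟩
        have h1 : (a : ℝ) ≤ z := (Nat.le_floor_iff hz0).1 ha.1.2
        have h2 : (a : ℝ) ≤ n := by nlinarith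
        exact_mod_cast h2
      have h1 : (((Ioc 0 ⌊z⌋₊).filter fun a => Nat.Coprime a n).card : ℝ) ≤
          ∑ a ∈ numerators n, ∫ x in Set.Iic y, bump ((a : ℝ) / n) ρ x := by
        calc _ = ∑ a ∈ (Ioc 0 ⌊z⌋₊).filter fun a => Nat.Coprime a n, (1 : ℝ) := by simp
          _ ≤ ∑ a ∈ (Ioc 0 ⌊z⌋₊).filter fun a => Nat.Coprime a n,
              ∫ x in Set.Iic y, bump ((a : ℝ) / n) ρ x := by
              refine sum_le_sum fun a ha => ?_
              simp only [mem_filter, mem_Ioc] at ha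
              have ha1 : (a : ℝ) ≤ z := (Nat.le_floor_iff hz0).1 ha.1.2
              rw [← integral_bump (c := (a : ℝ) / n) hρ]
              refine (setIntegral_eq_integral_of_forall_compl_eq_zero fun x hx => ?_).ge
              refine Set.indicator_of_notMem (fun hx' => hx ?_) _
              refine hx'.2.trans ?_
              rw [← sub_nonneg]
              have e : y - ((a : ℝ) / n + ρ) = (y * n - a - ρ * n) / n := by field_simp; ring
              rw [e]
              exact div_nonneg (by linarith) hn'.le
          _ ≤ _ := sum_le_sum_of_subset_of_nonneg hsub fun _ _ _ => setIntegral_bump_nonneg hρ _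
      have h2 := (abs_le.1 (abs_card_coprime_sub_le hn.ne' hz0)).1
      have e : z * n.totient / n = y * n.totient - n.totient / n := by
        rw [hz]; field_simp
      linarith
  · set z := y * n + 1 with hz
    have hz0 : 0 ≤ z := by positivity
    have h1 : ∑ a ∈ numerators n, ∫ x in Set.Iic y, bump ((a : ℝ) / n) ρ x ≤
        (((Ioc 0 ⌊z⌋₊).filter fun a => Nat.Coprime a n).card : ℝ) := by
      classical
      refine le_trans ?_ (hcard z (fun a => (a : ℝ) ≤ z) fun _ _ h => h)
      rw [card_filter]
      push_cast
      refine sum_le_sum fun a _ => ?_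
      split_ifs with ha
      · exact setIntegral_bump_le_one hρ _
      · refine (setIntegral_bump_eq_zero fun x hx hx' => ha ?_).le
        have h3 := hx'.1.trans hx
        have e : (a : ℝ) = ((a : ℝ) / n - ρ) * n + ρ * n := by field_simp; ring
        rw [e, hz]
        gcongr
    have h2 := (abs_le.1 (abs_card_coprime_sub_le hn.ne' hz0)).2
    have e : z * n.totient / n = y * n.totient + n.totient / n := by
      rw [hz]; field_simp
    linarith

theorem eventually_totient_bounds {δ : ℝ} (hδ : 0 < δ) :
    ∀ᶠ n : ℕ in atTop, (n : ℝ) ≤ (n : ℝ) ^ δ * n.totient ∧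
      (n.divisors.card : ℝ) + 1 ≤ (n : ℝ) ^ (δ - 1) * n.totient := by
  -- Two of the three factors `n ^ (δ / 3)` pay for divisor bounds, the third for the constant `2 *
  -- C ^ 2`.
  obtain ⟨C, hC1, hC⟩ := card_divisors_le_const_mul_rpow (δ := δ / 3) (by positivity)
  have hlim : Tendsto (fun n : ℕ => (n : ℝ) ^ (δ / 3)) atTop atTop :=
    (tendsto_rpow_atTop (by positivity)).comp tendsto_natCast_atTop_atTop
  filter_upwards [hlim.eventually_ge_atTop (2 * C ^ 2), eventually_ge_atTop 1] with n hn hn1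
  have hn0 : (0 : ℝ) < n := by exact_mod_cast hn1
  set u := (n : ℝ) ^ (δ / 3) with hu
  have hu0 : 0 < u := Real.rpow_pos_of_pos hn0 _
  have htau := hC n (by omega)
  have hphi : (n : ℝ) ≤ n.totient * (C * u) := by
    calc (n : ℝ) ≤ n.totient * n.divisors.card := by
          exact_mod_cast le_totient_mul_card_divisors n
      _ ≤ _ := by gcongr
  have hδu : (n : ℝ) ^ δ = u ^ 3 := by
    rw [hu, ← Real.rpow_natCast, ← Real.rpow_mul hn0.le]; norm_num
  have hphi0 : (0 : ℝ) ≤ n.totient := by positivity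
  have hC2 : C ≤ C ^ 2 := by nlinarith
  have hu1 : 1 ≤ u := by nlinarith
  constructor
  · rw [hδu]
    calc (n : ℝ) ≤ n.totient * (C * u) := hphi
      _ ≤ n.totient * (u * u * u) := by
          gcongr
          nlinarith
      _ = _ := by ring
  · rw [Real.rpow_sub_one hn0.ne', hδu]
    have h1 : (n.divisors.card : ℝ) + 1 ≤ 2 * C * u := by
      have : 1 ≤ C * u := one_le_mul_of_one_le_of_one_le hC1 hu1
      linarith
    rw [div_mul_eq_mul_div, le_div_iff₀ hn0]
    calc _ ≤ 2 * C * u * (n.totient * (C * u)) := by gcongr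
      _ = 2 * C ^ 2 * (u ^ 2 * n.totient) := by ring
      _ ≤ u * (u ^ 2 * n.totient) := by gcongr
      _ = _ := by ring

/-- Otherwise the block sums are eventually dominated by a convergent geometric series. -/
theorem frequently_le_sum_dyadic {a : ℕ → ℝ} (ha : ∀ n, 0 ≤ a n) (hs : ¬ Summable a) {q : ℝ}
    (hq0 : 0 ≤ q) (hq1 : q < 1) :
    ∃ᶠ k : ℕ in atTop, q ^ k ≤ ∑ n ∈ Ico (2 ^ k) (2 ^ (k + 1)), a n := by
  by_contra hcon
  rw [not_frequently] at hcon
  have hsum : Summable fun k : ℕ => ∑ n ∈ Ico (2 ^ k) (2 ^ (k + 1)), a n := by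
    refine Summable.of_norm_bounded_eventually_nat (summable_geometric_of_lt_one hq0 hq1) ?_
    filter_upwards [hcon] with k hk
    rw [Real.norm_of_nonneg (sum_nonneg fun _ _ => ha _)]
    exact (not_le.1 hk).le
  refine hs (summable_of_sum_range_le (c := a 0 + ∑' k : ℕ, ∑ n ∈ Ico (2 ^ k) (2 ^ (k + 1)), a n)
    ha fun n => ?_)
  have hpart : ∀ K : ℕ, ∑ n ∈ range (2 ^ K), a n =
      a 0 + ∑ k ∈ range K, ∑ n ∈ Ico (2 ^ k) (2 ^ (k + 1)), a n := by
    intro K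
    induction K with
    | zero => simp
    | succ K ih =>
      rw [sum_range_succ, ← add_assoc, ← ih, range_eq_Ico, range_eq_Ico,
        sum_Ico_consecutive _ (by positivity) (Nat.pow_le_pow_right (by norm_num) (by omega))]
  calc _ ≤ ∑ n ∈ range (2 ^ n), a n :=
        sum_le_sum_of_subset_of_nonneg (range_mono Nat.lt_two_pow_self.le) fun _ _ _ => ha _
    _ ≤ _ := by
        rw [hpart]
        gcongr
        exact hsum.sum_le_tsum _ fun _ _ => sum_nonneg fun _ _ => ha _

section Distribution

variable {S : Finset ℕ} {w ρ : ℕ → ℝ} {ε : ℝ}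

theorem abs_setIntegral_Iic_fractionDensity_sub_le (hS : ∀ n ∈ S, 0 < n)
    (hw : ∀ n ∈ S, 0 ≤ w n) (hρ : ∀ n ∈ S, 0 < ρ n) (hρn : ∀ n ∈ S, ρ n ≤ 1 / n)
    (hmass : ∑ n ∈ S, w n * n.totient = 1)
    (hε : ∀ n ∈ S, (n.divisors.card : ℝ) + 1 ≤ ε * n.totient)
    {y : ℝ} (hy0 : 0 ≤ y) (hy1 : y ≤ 1) :
    |(∫ x in Set.Iic y, fractionDensity S w ρ x) - y| ≤ ε := by
  have hz : ∀ z : ℝ, ∑ n ∈ S, w n * (z * n.totient) = z := fun z => by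
    rw [sum_congr rfl fun n _ => mul_left_comm (w n) z _, ← mul_sum, hmass, mul_one]
  have hsub : (∫ x in Set.Iic y, fractionDensity S w ρ x) - y =
      (∫ x in Set.Iic y, fractionDensity S w ρ x) - ∑ n ∈ S, w n * (y * n.totient) := by rw [hz]
  rw [hsub, setIntegral_fractionDensity, ← sum_sub_distrib, ← hz ε]
  refine (abs_sum_le_sum_abs _ _).trans (sum_le_sum fun n hn => ?_)
  rw [← mul_sub, abs_mul, abs_of_nonneg (hw n hn)]
  exact mul_le_mul_of_nonneg_left ((sum_numerators_setIntegral_Iic_bump (hS n hn) (hρ n hn)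
    (hρn n hn) hy0 hy1).trans (hε n hn)) (hw n hn)

theorem setIntegral_Ioc_eq_sub {f : ℝ → ℝ} (hf : Integrable f) {x y : ℝ} (hxy : x ≤ y) :
    ∫ u in Set.Ioc x y, f u = (∫ u in Set.Iic y, f u) - ∫ u in Set.Iic x, f u := by
  rw [eq_sub_iff_add_eq', ← setIntegral_union (Set.Iic_disjoint_Ioc le_rfl) measurableSet_Ioc
    hf.integrableOn hf.integrableOn, Set.Iic_union_Ioc_eq_Iic hxy]

/-- Cells may protrude from `[0, 1]`; monotonicity and total mass 1 extend the upper bound to the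
whole line. -/
theorem setIntegral_Ioc_le_of_Iic {f : ℝ → ℝ} (hf : Integrable f) (hf0 : ∀ x, 0 ≤ f x)
    (hf1 : ∫ x, f x = 1)
    (hF : ∀ y, 0 ≤ y → y ≤ 1 → |(∫ x in Set.Iic y, f x) - y| ≤ ε) {x y : ℝ} (hxy : x ≤ y) :
    ∫ u in Set.Ioc x y, f u ≤ y - x + 2 * ε := by
  rw [setIntegral_Ioc_eq_sub hf hxy]
  set F : ℝ → ℝ := fun y => ∫ x in Set.Iic y, f x with hFdef
  have hmono : ∀ {a b : ℝ}, a ≤ b → F a ≤ F b := fun h =>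
    setIntegral_mono_set hf.integrableOn (ae_of_all _ hf0) (Set.Iic_subset_Iic.2 h).eventuallyLE
  have hF0 : ∀ y, 0 ≤ F y := fun y => integral_nonneg hf0
  have hF1 : ∀ y, F y ≤ 1 := fun y => by
    rw [← hf1]; exact setIntegral_le_integral hf (ae_of_all _ hf0)
  have hup : ∀ z, 0 ≤ z → F z ≤ z + ε := by
    intro z hz
    have hε0 : 0 ≤ ε := (abs_nonneg _).trans (hF 0 le_rfl zero_le_one)
    rcases le_total z 1 with h | h
    · linarith [(abs_le.1 (hF z hz h)).2]
    · linarith [hF1 z]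
  have hlow : ∀ z, z ≤ 1 → z - ε ≤ F z := by
    intro z hz
    have hε0 : 0 ≤ ε := (abs_nonneg _).trans (hF 0 le_rfl zero_le_one)
    rcases le_total z 0 with h | h
    · linarith [hF0 z]
    · linarith [(abs_le.1 (hF z h hz)).1]
  have hε0 : 0 ≤ ε := (abs_nonneg _).trans (hF 0 le_rfl zero_le_one)
  change F y - F x ≤ _
  rcases le_total y 0 with h | h
  · linarith [hmono h, hup 0 le_rfl, hF0 x]
  · rcases le_total x 1 with h' | h'
    · linarith [hup y h, hlow x h']
    · linarith [hmono h', hlow 1 le_rfl, hF1 y]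

theorem abs_setIntegral_Ioc_sub_le_of_Iic {f : ℝ → ℝ} (hf : Integrable f)
    (hF : ∀ y, 0 ≤ y → y ≤ 1 → |(∫ x in Set.Iic y, f x) - y| ≤ ε) {x y : ℝ} (hx : 0 ≤ x)
    (hxy : x ≤ y) (hy : y ≤ 1) : |(∫ u in Set.Ioc x y, f u) - (y - x)| ≤ 2 * ε := by
  rw [setIntegral_Ioc_eq_sub hf hxy]
  have h1 := abs_le.1 (hF x hx (hxy.trans hy))
  have h2 := abs_le.1 (hF y (hx.trans hxy) hy)
  rw [abs_le]
  constructor <;> linarith [h1.1, h1.2, h2.1, h2.2]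

end Distribution

/-! ### The density attached to `ψ` -/

/-- Real linear combinations of indicator functions of bounded closed intervals. -/
def IsStep (f : ℝ → ℝ) : Prop :=
  f ∈ Submodule.span ℝ {g : ℝ → ℝ | ∃ a b : ℝ, g = (Set.Icc a b).indicator 1}

theorem isStep_fractionDensity (S : Finset ℕ) (w ρ : ℕ → ℝ) :
    IsStep (fractionDensity S w ρ) := by
  have e : fractionDensity S w ρ = ∑ n ∈ S, w n • ∑ a ∈ numerators n, (2 * ρ n)⁻¹ •
      (Set.Icc ((a : ℝ) / n - ρ n) ((a : ℝ) / n + ρ n)).indicator (1 : ℝ → ℝ) := by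
    ext x
    simp only [fractionDensity, bump, Finset.sum_apply, Pi.smul_apply, smul_eq_mul]
    refine sum_congr rfl fun n _ => congrArg _ (sum_congr rfl fun a _ => ?_)
    by_cases h : x ∈ Set.Icc ((a : ℝ) / n - ρ n) ((a : ℝ) / n + ρ n) <;> simp [h]
  rw [IsStep, e]
  exact Submodule.sum_mem _ fun n _ => Submodule.smul_mem _ _ <| Submodule.sum_mem _ fun a _ =>
    Submodule.smul_mem _ _ <| Submodule.subset_span ⟨_, _, rfl⟩

/-- Half the radius of the intervals making up `E ψ n`, capped at `1 / (2 n)`. -/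
noncomputable def radius (ψ : ℕ → ℝ) (n : ℕ) : ℝ := min (ψ n / n) (1 / n) / 2

theorem radius_nonneg {ψ : ℕ → ℝ} (hψ : ∀ n : ℕ, 1 ≤ n → 0 ≤ ψ n) (n : ℕ) : 0 ≤ radius ψ n := by
  rcases Nat.eq_zero_or_pos n with rfl | hn
  · simp [radius]
  · have := hψ n hn
    unfold radius
    positivity

/-- If the cap is active infinitely often, the terms do not tend to 0, because `φ(n) ≥ n ^ t`
eventually. Otherwise only the factor `2 ^ t` is lost. -/
theorem not_summable_radius {ψ : ℕ → ℝ} (hψ : ∀ n : ℕ, 1 ≤ n → 0 ≤ ψ n) {t : ℝ} (ht1 : t < 1)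
    (hdiv : ¬ Summable fun n : ℕ => (ψ n / (n : ℝ)) ^ t * (Nat.totient n : ℝ)) :
    ¬ Summable fun n : ℕ => radius ψ n ^ t * (Nat.totient n : ℝ) := by
  intro hs
  have hlim := hs.tendsto_atTop_zero
  have hsmall : ∀ᶠ n : ℕ in atTop, ψ n ≤ 1 := by
    filter_upwards [hlim.eventually_lt_const (show (0 : ℝ) < (1 / 2) ^ t by positivity),
      eventually_totient_bounds (δ := 1 - t) (by linarith), eventually_ge_atTop 1]
      with n hn hphi hn1
    by_contra hcon
    have hn0 : (0 : ℝ) < n := by exact_mod_cast hn1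
    have hr : radius ψ n = 1 / n * (1 / 2) := by
      rw [radius, min_eq_right (by gcongr; exact (not_le.1 hcon).le)]; ring
    rw [hr, Real.mul_rpow (by positivity) (by positivity), one_div, Real.inv_rpow hn0.le] at hn
    have h1 := hphi.1
    rw [Real.rpow_sub hn0, Real.rpow_one] at h1
    have hnt : 0 < (n : ℝ) ^ t := by positivity
    have h2 : 1 ≤ ((n : ℝ) ^ t)⁻¹ * n.totient := by
      have : (n : ℝ) * 1 ≤ n * (((n : ℝ) ^ t)⁻¹ * n.totient) := by
        calc (n : ℝ) * 1 = n := mul_one _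
          _ ≤ _ := h1
          _ = _ := by ring
      exact le_of_mul_le_mul_left this hn0
    have h3 : (1 / 2 : ℝ) ^ t * 1 ≤ (1 / 2 : ℝ) ^ t * (((n : ℝ) ^ t)⁻¹ * n.totient) := by gcongr
    linarith
  refine hdiv ((hs.mul_left ((2 : ℝ) ^ t)).congr_atTop ?_)
  filter_upwards [hsmall, eventually_ge_atTop 1] with n hn hn1
  have hn0 : (0 : ℝ) < n := by exact_mod_cast hn1
  rw [radius, min_eq_left (by gcongr), ← mul_assoc, ← Real.mul_rpow (by norm_num)
    (by have := hψ n hn1; positivity), mul_div_cancel₀ _ two_ne_zero]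

theorem coe_mem_E {ψ : ℕ → ℝ} {n a : ℕ} (hr : 0 < radius ψ n)
    (ha : a ∈ numerators n) {x : ℝ}
    (hx : x ∈ Set.Icc ((a : ℝ) / n - radius ψ n) ((a : ℝ) / n + radius ψ n)) :
    (x : UnitAddCircle) ∈ E ψ n := by
  have hlt : radius ψ n < ψ n / n := by
    have : radius ψ n ≤ ψ n / n / 2 := by unfold radius; gcongr; exact min_le_left _ _
    linarith
  simp only [numerators, mem_filter, mem_Ioc] at ha
  simp only [E, Set.mem_iUnion, Set.mem_image]
  refine ⟨a, ?_, x, ⟨?_, ?_⟩, rfl⟩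
  · simp only [mem_filter, mem_Icc]
    exact ⟨⟨ha.1.1, ha.1.2⟩, ha.2⟩
  · rw [sub_div]; linarith [hx.1]
  · rw [add_div]; linarith [hx.2]

/-- Since `min 1 x ≤ x ^ t`, the diagonal energy with weight `ρ ^ t` again sums to the normalising
constant; this dictates the weights. -/
theorem rpow_mul_sq_mul_min_le {ρ h t : ℝ} (hρ : 0 < ρ) (hh : 0 < h) (ht0 : 0 < t) (ht1 : t < 1) :
    (ρ ^ t) ^ 2 * min 1 (h / ρ) ≤ ρ ^ t * h ^ t := by
  have h1 : min 1 (h / ρ) ≤ (h / ρ) ^ t := by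
    rcases le_total 1 (h / ρ) with hle | hle
    · exact (min_le_left _ _).trans (Real.one_le_rpow hle ht0.le)
    · exact (min_le_right _ _).trans
        (Real.self_le_rpow_of_le_one (by positivity) hle ht1.le)
  calc _ ≤ (ρ ^ t) ^ 2 * (h / ρ) ^ t := by gcongr
    _ = _ := by
      rw [Real.div_rpow hh.le hρ.le]
      have : ρ ^ t ≠ 0 := (Real.rpow_pos_of_pos hρ t).ne'
      field_simp

theorem sum_cell_sq_le_of_large {f : ℝ → ℝ} {ε h : ℝ} (hf : Integrable f) (hf0 : ∀ x, 0 ≤ f x)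
    (hf1 : ∫ x, f x = 1)
    (hF : ∀ y, 0 ≤ y → y ≤ 1 → |(∫ x in Set.Iic y, f x) - y| ≤ ε) (hh : 0 < h) (hεh : ε ≤ h)
    (s : Finset ℤ) : ∑ i ∈ s, (∫ x in cell h i, f x) ^ 2 ≤ 8 * h := by
  have hc : ∀ i, ∫ x in cell h i, f x ≤ 4 * h := fun i => by
    rw [cell, ← integral_Ioc_eq_integral_Ioo]
    have := setIntegral_Ioc_le_of_Iic (x := i * h) (y := (i + 2) * h) hf hf0 hf1 hF (by nlinarith)
    linarith
  calc _ ≤ ∑ i ∈ s, 4 * h * ∫ x in cell h i, f x := by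
        refine sum_le_sum fun i _ => ?_
        rw [sq]
        exact mul_le_mul_of_nonneg_right (hc i) (integral_nonneg hf0)
    _ ≤ 4 * h * (2 * ∫ x, f x) := by
        rw [← mul_sum]
        gcongr
        exact sum_setIntegral_cell_le hh hf hf0 s
    _ = 8 * h := by rw [hf1]; ring

theorem sum_cell_sq_le_of_small {S : Finset ℕ} {ρ : ℕ → ℝ} {t h A L : ℝ} (hS : ∀ n ∈ S, 0 < n)
    (hρ : ∀ n ∈ S, 0 < ρ n) (ht0 : 0 < t) (ht1 : t < 1) (hh : 0 < h) (hA0 : 0 < A)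
    (hA : ∑ n ∈ S, ρ n ^ t * n.totient = A) (hL : ∀ n ∈ S, (n : ℝ) ≤ L * n.totient)
    (s : Finset ℤ) :
    ∑ i ∈ s, (∫ x in cell h i, fractionDensity S (fun n => ρ n ^ t / A) ρ x) ^ 2 ≤
      16 * h * L ^ 2 + 2 * h ^ t / A := by
  have hpos : ∀ n ∈ S, 0 < ρ n ^ t := fun n hn => Real.rpow_pos_of_pos (hρ n hn) t
  refine (sum_cell_fractionDensity_sq_le hS (fun n hn => (div_pos (hpos n hn) hA0).le) hρ hh
    s).trans (add_le_add ?_ ?_)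
  · gcongr
    · exact sum_nonneg fun n hn => mul_nonneg (div_pos (hpos n hn) hA0).le (Nat.cast_nonneg n)
    · calc _ ≤ ∑ n ∈ S, ρ n ^ t / A * (L * n.totient) := sum_le_sum fun n hn =>
            mul_le_mul_of_nonneg_left (hL n hn) (div_pos (hpos n hn) hA0).le
        _ = L * ((∑ n ∈ S, ρ n ^ t * n.totient) / A) := by
            rw [sum_div, mul_sum]; exact sum_congr rfl fun n _ => by ring
        _ = L := by rw [hA, div_self hA0.ne', mul_one]
  · rw [mul_div_assoc]
    gcongr
    calc _ ≤ ∑ n ∈ S, ρ n ^ t * n.totient * (h ^ t / A ^ 2) := by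
          refine sum_le_sum fun n hn => ?_
          have := rpow_mul_sq_mul_min_le (hρ n hn) hh ht0 ht1
          calc _ = (ρ n ^ t) ^ 2 * min 1 (h / ρ n) * (n.totient / A ^ 2) := by ring
            _ ≤ ρ n ^ t * h ^ t * (n.totient / A ^ 2) := by gcongr
            _ = _ := by ring
      _ = h ^ t / A := by rw [← sum_mul, hA]; field_simp

/-- The energy bound has an absolute constant at every scale, although `f` depends on `η` and `m`;
this uniformity drives the iteration. -/
theorem exists_step_density {ψ : ℕ → ℝ} (hψ : ∀ n : ℕ, 1 ≤ n → 0 ≤ ψ n)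
    (hdiv : ∀ ε : ℝ, 0 < ε → ε < 1 →
      ¬ Summable (fun n : ℕ => (ψ n / (n : ℝ)) ^ (1 - ε) * (Nat.totient n : ℝ)))
    {σ : ℝ} (hσ0 : 0 < σ) (hσ1 : σ < 1) {η : ℝ} (hη : 0 < η) (m : ℕ) :
    ∃ f : ℝ → ℝ, IsStep f ∧ (∀ x, 0 ≤ f x) ∧
      (∃ K : Set ℝ, IsClosed K ∧ (∀ x ∈ K, ∃ n ≥ m, (x : UnitAddCircle) ∈ E ψ n) ∧
        ∀ x ∉ K, f x = 0) ∧
      (∀ a b : ℝ, 0 ≤ a → a ≤ b → b ≤ 1 → |(∫ x in Set.Ioc a b, f x) - (b - a)| ≤ η) ∧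
      ∀ (j : ℕ) (s : Finset ℤ),
        ∑ i ∈ s, (∫ x in cell ((1 / 2) ^ j) i, f x) ^ 2 ≤ 100 * ((1 / 2 : ℝ) ^ j) ^ σ := by
  -- The gap `1 - σ` is shared equally: `t = 1 - γ` is the exponent in the divergent series, and `h
  -- ^ t = h ^ σ * h ^ γ` leaves `h ^ γ` to absorb losses.
  set γ := (1 - σ) / 2 with hγ
  have hγ0 : 0 < γ := by rw [hγ]; linarith
  have hγ1 : γ < 1 / 2 := by rw [hγ]; linarith
  set δ := γ / 4 with hδ
  have hδ0 : 0 < δ := by positivity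
  set t := 1 - γ with ht
  have ht0 : 0 < t := by linarith
  have ht1 : t < 1 := by linarith
  have hns := not_summable_radius hψ ht1 (hdiv γ hγ0 (by linarith))
  have hfreq := frequently_le_sum_dyadic
    (fun n => mul_nonneg (Real.rpow_nonneg (radius_nonneg hψ n) t) (Nat.cast_nonneg _)) hns
    (q := (2 : ℝ) ^ (-δ)) (by positivity) (Real.rpow_lt_one_of_one_lt_of_neg (by norm_num)
      (by linarith))
  obtain ⟨n₀, hn₀⟩ := eventually_atTop.1 (eventually_totient_bounds hδ0)
  have hpow : Tendsto (fun k : ℕ => 2 ^ k) atTop atTop :=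
    tendsto_pow_atTop_atTop_of_one_lt (by norm_num)
  have hsmall : Tendsto (fun k : ℕ => (((2 ^ k : ℕ) : ℝ)) ^ (δ - 1)) atTop (nhds 0) := by
    have h1 : Tendsto (fun k : ℕ => (((2 ^ k : ℕ) : ℝ))) atTop atTop :=
      tendsto_natCast_atTop_atTop.comp hpow
    have := (tendsto_rpow_neg_atTop (y := 1 - δ) (by linarith)).comp h1
    simpa [Function.comp_def] using this
  obtain ⟨k, hk, hkn₀, hkm, hkη⟩ := (hfreq.and_eventually ((hpow.eventually_ge_atTop n₀).and
    ((hpow.eventually_ge_atTop m).and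
      (hsmall.eventually_lt_const (show (0 : ℝ) < η / 2 by positivity))))).exists
  set N : ℝ := ((2 ^ k : ℕ) : ℝ) with hN
  have hN1 : 1 ≤ N := by rw [hN]; exact_mod_cast Nat.one_le_two_pow
  have hN0 : 0 < N := by linarith
  classical
  set ρ := radius ψ with hρdef
  set S := (Ico (2 ^ k) (2 ^ (k + 1))).filter fun n => 0 < ρ n with hSdef
  have hSN : ∀ n ∈ S, 2 ^ k ≤ n ∧ n < 2 ^ (k + 1) := fun n hn => by
    simpa using (mem_filter.1 hn).1
  have hS : ∀ n ∈ S, 0 < n := fun n hn => lt_of_lt_of_le (by positivity) (hSN n hn).1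
  have hρ : ∀ n ∈ S, 0 < ρ n := fun n hn => (mem_filter.1 hn).2
  set A := ∑ n ∈ S, ρ n ^ t * n.totient with hA
  have hAN : N ^ (-δ) ≤ A := by
    have e : ((2 : ℝ) ^ (-δ)) ^ k = N ^ (-δ) := by
      rw [hN]; push_cast
      rw [← Real.rpow_natCast, ← Real.rpow_mul (by norm_num), mul_comm, Real.rpow_mul (by norm_num),
        Real.rpow_natCast]
    rw [← e, hA, hSdef]
    refine hk.trans_eq (sum_subset (filter_subset _ _) fun n hn hn' => ?_).symm
    have h0 : ρ n = 0 := by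
      refine le_antisymm ?_ (radius_nonneg hψ n)
      simpa [hn] using fun h => hn' (mem_filter.2 ⟨hn, h⟩)
    rw [h0, Real.zero_rpow ht0.ne', zero_mul]
  have hA0 : 0 < A := lt_of_lt_of_le (by positivity) hAN
  set w : ℕ → ℝ := fun n => ρ n ^ t / A with hw
  have hw0 : ∀ n ∈ S, 0 ≤ w n := fun n hn =>
    div_nonneg (Real.rpow_nonneg (hρ n hn).le t) hA0.le
  have hmass : ∑ n ∈ S, w n * n.totient = 1 := by
    rw [← div_self hA0.ne']
    nth_rw 2 [hA]
    rw [sum_div]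
    exact sum_congr rfl fun n _ => by rw [hw]; ring
  set f := fractionDensity S w ρ with hf
  have hfi : Integrable f := integrable_fractionDensity S w ρ
  have hf0 : ∀ x, 0 ≤ f x := fractionDensity_nonneg hw0 hρ
  have hf1 : ∫ x, f x = 1 := by rw [hf, integral_fractionDensity hρ, hmass]
  set ε := N ^ (δ - 1) with hε
  have hρn : ∀ n ∈ S, ρ n ≤ 1 / n := fun n hn => by
    have h1 : (0 : ℝ) ≤ 1 / n := by positivity
    have h2 : ρ n ≤ 1 / n / 2 := by
      rw [hρdef]; unfold radius; gcongr; exact min_le_right _ _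
    linarith
  have hNn : ∀ n ∈ S, N ≤ n := fun n hn => by rw [hN]; exact_mod_cast (hSN n hn).1
  have hnN : ∀ n ∈ S, (n : ℝ) ≤ 2 * N := fun n hn => by
    rw [hN]
    have := (hSN n hn).2.le
    rw [pow_succ'] at this
    exact_mod_cast this
  have hbd : ∀ n ∈ S, _ := fun n hn => hn₀ n (hkn₀.trans (hSN n hn).1)
  have hF : ∀ y, 0 ≤ y → y ≤ 1 → |(∫ x in Set.Iic y, f x) - y| ≤ ε := fun y hy0 hy1 =>
    abs_setIntegral_Iic_fractionDensity_sub_le hS hw0 hρ hρn hmass (fun n hn => by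
      refine (hbd n hn).2.trans ?_
      gcongr
      exact Real.rpow_le_rpow_of_nonpos hN0 (hNn n hn) (by linarith)) hy0 hy1
  refine ⟨f, isStep_fractionDensity S w ρ, hf0, ?_, ?_, ?_⟩
  · refine ⟨⋃ n ∈ S, ⋃ a ∈ numerators n, Set.Icc ((a : ℝ) / n - ρ n) ((a : ℝ) / n + ρ n),
      ?_, ?_, ?_⟩
    · exact isClosed_biUnion_finset fun n _ => isClosed_biUnion_finset fun a _ => isClosed_Icc
    · intro x hx
      simp only [Set.mem_iUnion] at hx
      obtain ⟨n, hn, a, ha, hx⟩ := hx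
      exact ⟨n, hkm.trans (hSN n hn).1, coe_mem_E (hρ n hn) ha hx⟩
    · intro x hx
      simp only [Set.mem_iUnion, not_exists] at hx
      refine sum_eq_zero fun n hn => ?_
      rw [sum_eq_zero fun a ha => ?_, mul_zero]
      exact Set.indicator_of_notMem (hx n hn a ha) _
  · intro a b ha hab hb
    refine (abs_setIntegral_Ioc_sub_le_of_Iic hfi hF ha hab hb).trans ?_
    linarith
  · intro j s
    set h : ℝ := (1 / 2) ^ j with hh
    have hh0 : 0 < h := by positivity
    have hh1 : h ≤ 1 := pow_le_one₀ (by norm_num) (by norm_num)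
    -- Above scale `N ^ (-1/2)` the discrepancy `N ^ (δ - 1)` is at most `h`. Below it, `h ^ γ ≤ N ^
    -- (-2δ)` because `γ = 4δ`, which cancels the losses in the pair count and in `1 / A`.
    rcases le_total (N ^ (-(1 / 2) : ℝ)) h with hle | hle
    · have hεh : ε ≤ h := by
        refine le_trans ?_ hle
        exact Real.rpow_le_rpow_of_exponent_le hN1 (by linarith)
      have h1 := sum_cell_sq_le_of_large hfi hf0 hf1 hF hh0 hεh s
      have h2 : h ≤ h ^ σ := Real.self_le_rpow_of_le_one hh0.le hh1 hσ1.le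
      linarith
    · have h1 := sum_cell_sq_le_of_small (L := (2 * N) ^ δ) hS hρ ht0 ht1 hh0 hA0 rfl
        (fun n hn => (hbd n hn).1.trans (by gcongr; exact hnN n hn)) s
      refine h1.trans ?_
      have hγh : h ^ γ * N ^ (2 * δ) ≤ 1 := by
        calc h ^ γ * N ^ (2 * δ) ≤ (N ^ (-(1 / 2) : ℝ)) ^ γ * N ^ (2 * δ) := by gcongr
          _ = 1 := by
              rw [← Real.rpow_mul hN0.le, ← Real.rpow_add hN0]
              rw [show -(1 / 2) * γ + 2 * δ = 0 by rw [hδ]; ring, Real.rpow_zero]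
      have hσt : h ^ t = h ^ σ * h ^ γ := by
        rw [← Real.rpow_add hh0]; congr 1; rw [ht, hγ]; ring
      have hht : h ≤ h ^ t := Real.self_le_rpow_of_le_one hh0.le hh1 ht1.le
      have hL : ((2 * N) ^ δ) ^ 2 ≤ 4 * N ^ (2 * δ) := by
        rw [Real.mul_rpow (by norm_num) hN0.le, mul_pow, ← Real.rpow_natCast (N ^ δ),
          ← Real.rpow_mul hN0.le, ← Real.rpow_natCast, ← Real.rpow_mul (by norm_num)]
        rw [show δ * ((2 : ℕ) : ℝ) = 2 * δ by push_cast; ring]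
        gcongr
        calc (2 : ℝ) ^ (2 * δ) ≤ (2 : ℝ) ^ (2 : ℝ) :=
              Real.rpow_le_rpow_of_exponent_le (by norm_num) (by linarith)
          _ = 4 := by norm_num
      have hAinv : 1 / A ≤ N ^ (2 * δ) := by
        calc 1 / A ≤ 1 / N ^ (-δ) := by gcongr
          _ = N ^ δ := by rw [Real.rpow_neg hN0.le]; simp
          _ ≤ _ := Real.rpow_le_rpow_of_exponent_le hN1 (by linarith)
      calc 16 * h * ((2 * N) ^ δ) ^ 2 + 2 * h ^ t / A
          = 16 * h * ((2 * N) ^ δ) ^ 2 + 2 * h ^ t * (1 / A) := by ring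
        _ ≤ 16 * h ^ t * (4 * N ^ (2 * δ)) + 2 * h ^ t * N ^ (2 * δ) := by gcongr
        _ = 66 * (h ^ σ * (h ^ γ * N ^ (2 * δ))) := by rw [hσt]; ring
        _ ≤ 100 * (h ^ σ * 1) := by gcongr; norm_num
        _ = _ := by rw [mul_one]

/-! ### Products of step functions and discrepancy -/

theorem isStep_indicator_Icc (a b : ℝ) : IsStep ((Set.Icc a b).indicator 1) :=
  Submodule.subset_span ⟨a, b, rfl⟩

theorem IsStep.mul {f g : ℝ → ℝ} (hf : IsStep f) (hg : IsStep g) : IsStep (f * g) := by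
  unfold IsStep at *
  induction hf, hg using Submodule.span_induction₂ with
  | mem_mem f g hf hg =>
    obtain ⟨a, b, rfl⟩ := hf
    obtain ⟨c, d, rfl⟩ := hg
    rw [← Set.inter_indicator_one, Set.Icc_inter_Icc]
    exact isStep_indicator_Icc _ _
  | zero_left g hg => rw [zero_mul]; exact Submodule.zero_mem _
  | zero_right f hf => rw [mul_zero]; exact Submodule.zero_mem _
  | add_left f f' g _ _ _ h1 h2 => rw [add_mul]; exact Submodule.add_mem _ h1 h2
  | add_right f g g' _ _ _ h1 h2 => rw [mul_add]; exact Submodule.add_mem _ h1 h2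
  | smul_left r f g _ _ h => rw [smul_mul_assoc]; exact Submodule.smul_mem _ _ h
  | smul_right r f g _ _ h => rw [mul_smul_comm]; exact Submodule.smul_mem _ _ h

theorem IsStep.integrable {f : ℝ → ℝ} (hf : IsStep f) : Integrable f := by
  unfold IsStep at hf
  induction hf using Submodule.span_induction with
  | mem f hf =>
    obtain ⟨a, b, rfl⟩ := hf
    rw [integrable_indicator_iff measurableSet_Icc]
    exact integrableOn_const (by simp)
  | zero => exact integrable_zero _ _ _
  | add f g _ _ h1 h2 => exact h1.add h2
  | smul r f _ h => exact h.smul r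

theorem IsStep.exists_bound {f : ℝ → ℝ} (hf : IsStep f) : ∃ M : ℝ, 0 ≤ M ∧ ∀ x, |f x| ≤ M := by
  unfold IsStep at hf
  induction hf using Submodule.span_induction with
  | mem f hf =>
    obtain ⟨a, b, rfl⟩ := hf
    refine ⟨1, zero_le_one, fun x => ?_⟩
    by_cases h : x ∈ Set.Icc a b <;> simp [h]
  | zero => exact ⟨0, le_rfl, by simp⟩
  | add f g _ _ h1 h2 =>
    obtain ⟨M, hM, h1⟩ := h1
    obtain ⟨M', hM', h2⟩ := h2
    exact ⟨M + M', by positivity, fun x => (abs_add_le _ _).trans (add_le_add (h1 x) (h2 x))⟩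
  | smul r f _ h =>
    obtain ⟨M, hM, h⟩ := h
    refine ⟨|r| * M, by positivity, fun x => ?_⟩
    rw [Pi.smul_apply, smul_eq_mul, abs_mul]
    gcongr
    exact h x

/-- For an indicator, the product is integrated over a smaller interval; the rest is linearity. The
constant depends on `g` alone, so `η` and `f` may be chosen afterwards. -/
theorem IsStep.exists_discrepancy_bound {g : ℝ → ℝ} (hg : IsStep g) :
    ∃ C : ℝ, 0 ≤ C ∧ ∀ (η : ℝ) (f : ℝ → ℝ), 0 ≤ η → IsStep f →
      (∀ a b : ℝ, 0 ≤ a → a ≤ b → b ≤ 1 → |(∫ x in Set.Ioc a b, f x) - (b - a)| ≤ η) →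
      ∀ a b : ℝ, 0 ≤ a → b ≤ 1 →
        |(∫ x in Set.Ioc a b, (g * f) x) - ∫ x in Set.Ioc a b, g x| ≤ C * η := by
  unfold IsStep at hg
  induction hg using Submodule.span_induction with
  | mem g hg =>
    obtain ⟨c, d, rfl⟩ := hg
    refine ⟨1, zero_le_one, fun η f hη hf h a b ha hb => ?_⟩
    have hae : (Set.Ioc a b ∩ Set.Icc c d : Set ℝ) =ᵐ[volume] Set.Ioc (max a c) (min b d) := by
      rw [← Set.Ioc_inter_Ioc]
      exact (ae_eq_refl _).inter Ioc_ae_eq_Icc.symm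
    have e1 : ∫ x in Set.Ioc a b, ((Set.Icc c d).indicator 1 * f : ℝ → ℝ) x =
        ∫ x in Set.Ioc (max a c) (min b d), f x := by
      have : ((Set.Icc c d).indicator 1 * f : ℝ → ℝ) = (Set.Icc c d).indicator f := by
        ext x; by_cases hx : x ∈ Set.Icc c d <;> simp [hx]
      rw [this, setIntegral_indicator measurableSet_Icc, setIntegral_congr_set hae]
    have e2 : ∫ x in Set.Ioc a b, (Set.Icc c d).indicator (1 : ℝ → ℝ) x =
        ∫ x in Set.Ioc (max a c) (min b d), (1 : ℝ) := by
      rw [setIntegral_indicator measurableSet_Icc, setIntegral_congr_set hae]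
      rfl
    rw [e1, e2, one_mul]
    rcases le_total (max a c) (min b d) with hle | hle
    · rw [setIntegral_const, Real.volume_real_Ioc_of_le hle, smul_eq_mul, mul_one]
      exact h _ _ (ha.trans (le_max_left _ _)) hle ((min_le_left _ _).trans hb)
    · rw [Set.Ioc_eq_empty (not_lt.2 hle)]
      simpa using hη
  | zero => exact ⟨0, le_rfl, fun η f hη hf h a b ha hb => by simp⟩
  | add g g' hg hg' h1 h2 =>
    obtain ⟨C, hC, h1⟩ := h1
    obtain ⟨C', hC', h2⟩ := h2
    refine ⟨C + C', by positivity, fun η f hη hf h a b ha hb => ?_⟩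
    have hi : ∀ {u : ℝ → ℝ}, IsStep u → IntegrableOn u (Set.Ioc a b) :=
      fun hu => hu.integrable.integrableOn
    have i1 := hi (IsStep.mul hg hf)
    have i2 := hi (IsStep.mul hg' hf)
    have e1 : ∫ x in Set.Ioc a b, ((g + g') * f) x =
        (∫ x in Set.Ioc a b, (g * f) x) + ∫ x in Set.Ioc a b, (g' * f) x := by
      rw [add_mul]; exact integral_add i1 i2
    have e2 : ∫ x in Set.Ioc a b, (g + g') x =
        (∫ x in Set.Ioc a b, g x) + ∫ x in Set.Ioc a b, g' x := integral_add (hi hg) (hi hg')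
    rw [e1, e2, add_sub_add_comm, add_mul]
    exact (abs_add_le _ _).trans (add_le_add (h1 η f hη hf h a b ha hb) (h2 η f hη hf h a b ha hb))
  | smul r g hg h1 =>
    obtain ⟨C, hC, h1⟩ := h1
    refine ⟨|r| * C, by positivity, fun η f hη hf h a b ha hb => ?_⟩
    have e1 : ∫ x in Set.Ioc a b, (r • g * f) x = r * ∫ x in Set.Ioc a b, (g * f) x := by
      rw [smul_mul_assoc]; exact integral_const_mul _ _
    have e2 : ∫ x in Set.Ioc a b, (r • g) x = r * ∫ x in Set.Ioc a b, g x :=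
      integral_const_mul _ _
    rw [e1, e2, ← mul_sub, abs_mul, mul_assoc]
    gcongr
    exact h1 η f hη hf h a b ha hb

theorem setIntegral_Ioo_eq_clamp {u : ℝ → ℝ} (hu : ∀ x ∉ Set.Ioc (0 : ℝ) 1, u x = 0) (a b : ℝ) :
    ∫ x in Set.Ioo a b, u x = ∫ x in Set.Ioc (max a 0) (min b 1), u x := by
  rw [← integral_Ioc_eq_integral_Ioo, ← Set.Ioc_inter_Ioc]
  have : u = (Set.Ioc (0 : ℝ) 1).indicator u := by
    ext x
    by_cases hx : x ∈ Set.Ioc (0 : ℝ) 1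
    · rw [Set.indicator_of_mem hx]
    · rw [Set.indicator_of_notMem hx, hu x hx]
  conv_lhs => rw [this]
  rw [setIntegral_indicator measurableSet_Ioc]

/-! ### Energy and the refinement step -/

/-- The energy of the density `g` at scale `2⁻ʲ`, normalised for dimension `s`. -/
noncomputable def scaleEnergy (s : ℝ) (g : ℝ → ℝ) (j : ℕ) : ℝ :=
  ((1 / 2 : ℝ) ^ j) ^ (-s) * ∑ i ∈ Icc (0 : ℤ) (2 ^ j), (∫ x in cell ((1 / 2) ^ j) i, g x) ^ 2

theorem scaleEnergy_nonneg (s : ℝ) (g : ℝ → ℝ) (j : ℕ) : 0 ≤ scaleEnergy s g j := by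
  unfold scaleEnergy
  exact mul_nonneg (by positivity) (sum_nonneg fun _ _ => sq_nonneg _)

theorem scaleEnergy_mul_le {s σ M : ℝ} {g f : ℝ → ℝ} (hg0 : ∀ x, 0 ≤ g x)
    (hgM : ∀ x, |g x| ≤ M) (hf : Integrable f) (hgf : Integrable (g * f)) (hf0 : ∀ x, 0 ≤ f x)
    (j : ℕ) (hE : ∀ t : Finset ℤ,
        ∑ i ∈ t, (∫ x in cell ((1 / 2) ^ j) i, f x) ^ 2 ≤ 100 * ((1 / 2 : ℝ) ^ j) ^ σ) :
    scaleEnergy s (g * f) j ≤ 100 * M ^ 2 * ((1 / 2 : ℝ) ^ (σ - s)) ^ j := by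
  have hh : (0 : ℝ) < (1 / 2) ^ j := by positivity
  have hcell : ∀ i, ∫ x in cell ((1 / 2) ^ j) i, (g * f) x ≤
      M * ∫ x in cell ((1 / 2) ^ j) i, f x := fun i => by
    rw [← integral_const_mul]
    refine integral_mono hgf.integrableOn (hf.const_mul M).integrableOn fun x => ?_
    exact mul_le_mul_of_nonneg_right ((le_abs_self _).trans (hgM x)) (hf0 x)
  have hnn : ∀ i, 0 ≤ ∫ x in cell ((1 / 2) ^ j) i, (g * f) x := fun i =>
    integral_nonneg fun x => mul_nonneg (hg0 x) (hf0 x)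
  calc scaleEnergy s (g * f) j ≤ ((1 / 2 : ℝ) ^ j) ^ (-s) *
        ∑ i ∈ Icc (0 : ℤ) (2 ^ j), (M * ∫ x in cell ((1 / 2) ^ j) i, f x) ^ 2 := by
        unfold scaleEnergy
        gcongr with i _
        · exact hnn i
        · exact hcell i
    _ = ((1 / 2 : ℝ) ^ j) ^ (-s) *
        (M ^ 2 * ∑ i ∈ Icc (0 : ℤ) (2 ^ j), (∫ x in cell ((1 / 2) ^ j) i, f x) ^ 2) := by
        simp_rw [mul_pow, ← mul_sum]
    _ ≤ ((1 / 2 : ℝ) ^ j) ^ (-s) * (M ^ 2 * (100 * ((1 / 2 : ℝ) ^ j) ^ σ)) := by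
        gcongr
        exact hE _
    _ = 100 * M ^ 2 * (((1 / 2 : ℝ) ^ j) ^ σ * ((1 / 2 : ℝ) ^ j) ^ (-s)) := by ring
    _ = _ := by
        rw [← Real.rpow_add hh, ← sub_eq_add_neg, Real.rpow_pow_comm (by norm_num)]

theorem exists_refinement {ψ : ℕ → ℝ} (hψ : ∀ n : ℕ, 1 ≤ n → 0 ≤ ψ n)
    (hdiv : ∀ ε : ℝ, 0 < ε → ε < 1 →
      ¬ Summable (fun n : ℕ => (ψ n / (n : ℝ)) ^ (1 - ε) * (Nat.totient n : ℝ)))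
    {s : ℝ} (hs0 : 0 < s) (hs1 : s < 1) {g : ℝ → ℝ} (hg : IsStep g) (hg0 : ∀ x, 0 ≤ g x)
    (hgs : ∀ x ∉ Set.Ioc (0 : ℝ) 1, g x = 0) {ε : ℝ} (hε : 0 < ε) (m : ℕ) :
    ∃ g' : ℝ → ℝ, IsStep g' ∧ (∀ x, 0 ≤ g' x) ∧ (∀ x, g x = 0 → g' x = 0) ∧
      (∃ K : Set ℝ, IsClosed K ∧ (∀ x ∈ K, ∃ n ≥ m, (x : UnitAddCircle) ∈ E ψ n) ∧
        ∀ x ∉ K, g' x = 0) ∧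
      (∫ x, g x) - ε ≤ ∫ x, g' x ∧
      ∀ B : ℝ, (∀ k, ∑ j ∈ range k, scaleEnergy s g j ≤ B) →
        ∀ k, ∑ j ∈ range k, scaleEnergy s g' j ≤ B + ε := by
  obtain ⟨M, hM0, hM⟩ := hg.exists_bound
  obtain ⟨C, hC0, hC⟩ := hg.exists_discrepancy_bound
  set σ := (1 + s) / 2 with hσ
  set r : ℝ := (1 / 2) ^ (σ - s) with hr
  have hr0 : 0 ≤ r := by positivity
  have hr1 : r < 1 := Real.rpow_lt_one (by norm_num) (by norm_num) (by linarith)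
  -- Beyond scale `J` the energy of any admissible product is negligible, since `σ > s`; only
  -- finitely many scales remain to be compared with `g`.
  obtain ⟨J, hJ⟩ : ∃ J : ℕ, 100 * M ^ 2 * (r ^ J / (1 - r)) < ε / 2 := by
    have : Tendsto (fun J : ℕ => 100 * M ^ 2 * (r ^ J / (1 - r))) atTop
        (nhds (100 * M ^ 2 * (0 / (1 - r)))) :=
      ((tendsto_pow_atTop_nhds_zero_of_lt_one hr0 hr1).div_const _).const_mul _
    rw [zero_div, mul_zero] at this
    exact (this.eventually_lt_const (by positivity)).exists
  -- `H η` is the coarse energy of `g` with every cell mass raised by the largest possible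
  -- discrepancy; continuity at 0 yields a suitable `η`.
  set H : ℝ → ℝ := fun η => ∑ j ∈ range J, ((1 / 2 : ℝ) ^ j) ^ (-s) *
    ∑ i ∈ Icc (0 : ℤ) (2 ^ j), ((∫ x in cell ((1 / 2) ^ j) i, g x) + C * η) ^ 2 with hH
  have hHc : Continuous H := by rw [hH]; fun_prop
  have hH0 : H 0 = ∑ j ∈ range J, scaleEnergy s g j := by
    simp [hH, scaleEnergy]
  obtain ⟨η, hη0, hηH, hηC⟩ : ∃ η : ℝ, 0 < η ∧ H η < H 0 + ε / 2 ∧ C * η < ε := by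
    have h1 : ∀ᶠ η in nhds (0 : ℝ), H η < H 0 + ε / 2 :=
      hHc.continuousAt.eventually_lt_const (by linarith)
    have h2 : ∀ᶠ η in nhds (0 : ℝ), C * η < ε :=
      (show Continuous fun η : ℝ => C * η by fun_prop).continuousAt.eventually_lt_const (by simpa)
    obtain ⟨η, ⟨h1, h2⟩, h3⟩ := (((h1.and h2).filter_mono nhdsWithin_le_nhds).and
      (self_mem_nhdsWithin (s := Set.Ioi (0 : ℝ)))).exists
    exact ⟨η, h3, h1, h2⟩
  obtain ⟨f, hf, hf0, ⟨K, hK, hKE, hKf⟩, hfη, hfE⟩ :=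
    exists_step_density hψ hdiv (σ := σ) (by linarith) (by linarith) hη0 m
  have hgf := hg.mul hf
  have hgf0 : ∀ x, 0 ≤ (g * f) x := fun x => mul_nonneg (hg0 x) (hf0 x)
  have hgfs : ∀ x ∉ Set.Ioc (0 : ℝ) 1, (g * f) x = 0 := fun x hx => by
    rw [Pi.mul_apply, hgs x hx, zero_mul]
  have hcell : ∀ a b : ℝ, ∫ x in Set.Ioo a b, (g * f) x ≤ (∫ x in Set.Ioo a b, g x) + C * η := by
    intro a b
    rw [setIntegral_Ioo_eq_clamp hgs, setIntegral_Ioo_eq_clamp hgfs]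
    have := (abs_le.1 (hC η f hη0.le hf hfη (max a 0) (min b 1) (le_max_right _ _)
      (min_le_right _ _))).2
    linarith
  refine ⟨g * f, hgf, hgf0, fun x hx => by rw [Pi.mul_apply, hx, zero_mul],
    ⟨K, hK, hKE, fun x hx => by rw [Pi.mul_apply, hKf x hx, mul_zero]⟩, ?_, ?_⟩
  · have hall : ∀ {u : ℝ → ℝ}, (∀ x ∉ Set.Ioc (0 : ℝ) 1, u x = 0) →
        ∫ x, u x = ∫ x in Set.Ioc (0 : ℝ) 1, u x := fun hu =>
      (setIntegral_eq_integral_of_forall_compl_eq_zero hu).symm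
    rw [hall hgs, hall hgfs]
    have := (abs_le.1 (hC η f hη0.le hf hfη 0 1 le_rfl le_rfl)).1
    linarith
  · have hhead : ∑ j ∈ range J, scaleEnergy s (g * f) j ≤
        (∑ j ∈ range J, scaleEnergy s g j) + ε / 2 := by
      rw [← hH0]
      refine le_trans ?_ hηH.le
      refine sum_le_sum fun j _ => ?_
      unfold scaleEnergy
      gcongr with i _
      · exact integral_nonneg hgf0
      · exact hcell _ _
    have htail : ∀ k, ∑ j ∈ Ico J (J + k), scaleEnergy s (g * f) j ≤ ε / 2 := by
      intro k
      calc _ ≤ ∑ j ∈ Ico J (J + k), 100 * M ^ 2 * r ^ j := sum_le_sum fun j _ =>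
            scaleEnergy_mul_le hg0 hM hf.integrable hgf.integrable hf0 j (hfE j)
        _ = 100 * M ^ 2 * (r ^ J * ∑ j ∈ range k, r ^ j) := by
            rw [← mul_sum, sum_Ico_eq_sum_range, Nat.add_sub_cancel_left]
            simp_rw [pow_add, ← mul_sum]
        _ ≤ 100 * M ^ 2 * (r ^ J / (1 - r)) := by
            rw [div_eq_mul_inv, ← tsum_geometric_of_lt_one hr0 hr1]
            gcongr
            exact (summable_geometric_of_lt_one hr0 hr1).sum_le_tsum _ fun _ _ => by positivity
        _ ≤ ε / 2 := hJ.le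
    intro B hB k
    calc _ ≤ ∑ j ∈ range (J + k), scaleEnergy s (g * f) j :=
          sum_le_sum_of_subset_of_nonneg (range_mono (Nat.le_add_left _ _))
            fun _ _ _ => scaleEnergy_nonneg _ _ _
      _ = (∑ j ∈ range J, scaleEnergy s (g * f) j) +
          ∑ j ∈ Ico J (J + k), scaleEnergy s (g * f) j :=
          (sum_range_add_sum_Ico _ (Nat.le_add_right _ _)).symm
      _ ≤ _ := by linarith [htail k, hB J]

theorem sum_scaleEnergy_indicator_le {s : ℝ} (hs1 : s < 1) (k : ℕ) :
    ∑ j ∈ range k, scaleEnergy s ((Set.Icc (1 / 4 : ℝ) (1 / 2)).indicator 1) j ≤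
      8 * (1 - (1 / 2 : ℝ) ^ (1 - s))⁻¹ := by
  set r : ℝ := (1 / 2) ^ (1 - s) with hr
  have hr0 : 0 ≤ r := by positivity
  have hr1 : r < 1 := Real.rpow_lt_one (by norm_num) (by norm_num) (by linarith)
  rw [← tsum_geometric_of_lt_one hr0 hr1]
  calc _ ≤ ∑ j ∈ range k, 8 * r ^ j := ?_
    _ = 8 * ∑ j ∈ range k, r ^ j := by rw [mul_sum]
    _ ≤ _ := by
      gcongr
      exact (summable_geometric_of_lt_one hr0 hr1).sum_le_tsum _ fun _ _ => by positivity
  refine sum_le_sum fun j _ => ?_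
  set h : ℝ := (1 / 2) ^ j with hh
  have hh0 : 0 < h := by positivity
  have hcell : ∀ i, ∫ x in cell h i, (Set.Icc (1 / 4 : ℝ) (1 / 2)).indicator (1 : ℝ → ℝ) x ≤
      2 * h := fun i => by
    calc _ ≤ ∫ x in cell h i, (1 : ℝ) := by
          refine integral_mono (isStep_indicator_Icc _ _).integrable.integrableOn
            (integrableOn_const (by simp [cell])) fun x => ?_
          exact Set.indicator_le_self' (fun _ _ => zero_le_one) x
      _ = 2 * h := by
          rw [setIntegral_const, cell, Real.volume_real_Ioo_of_le (by nlinarith), smul_eq_mul]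
          ring
  have hcard : (((Icc (0 : ℤ) (2 ^ j)).card : ℕ) : ℝ) * h ≤ 2 := by
    have e : (((Icc (0 : ℤ) (2 ^ j)).card : ℕ) : ℝ) = 2 ^ j + 1 := by
      rw [Int.card_Icc]
      have : ((2 : ℤ) ^ j + 1 - 0).toNat = 2 ^ j + 1 := by
        rw [sub_zero]; exact_mod_cast Int.toNat_natCast (2 ^ j + 1)
      rw [this]; push_cast; rfl
    have h1 : (2 : ℝ) ^ j * h = 1 := by rw [hh, ← mul_pow]; norm_num
    have h2 : h ≤ 1 := pow_le_one₀ (by norm_num) (by norm_num)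
    rw [e]; linarith
  calc scaleEnergy s ((Set.Icc (1 / 4 : ℝ) (1 / 2)).indicator 1) j
      ≤ h ^ (-s) * ∑ i ∈ Icc (0 : ℤ) (2 ^ j), (2 * h) ^ 2 := by
        unfold scaleEnergy
        gcongr with i _
        · exact integral_nonneg fun x => Set.indicator_nonneg (fun _ _ => zero_le_one) x
        · exact hcell i
    _ = 4 * h ^ (-s) * h * ((((Icc (0 : ℤ) (2 ^ j)).card : ℕ) : ℝ) * h) := by
        rw [sum_const, nsmul_eq_mul]; ring
    _ ≤ 4 * h ^ (-s) * h * 2 := by gcongr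
    _ = 8 * (h ^ (1 : ℝ) * h ^ (-s)) := by rw [Real.rpow_one]; ring
    _ = 8 * r ^ j := by
        rw [← Real.rpow_add hh0, ← sub_eq_add_neg, hh, hr, Real.rpow_pow_comm (by norm_num)]

/-! ### From bounded energy to positive Hausdorff measure -/

theorem sum_one_half_pow_le_two (F : Finset ℕ) : ∑ n ∈ F, (1 / 2 : ℝ) ^ n ≤ 2 :=
  (summable_geometric_two.sum_le_tsum F fun _ _ => by positivity).trans_eq tsum_geometric_two

/-- A dyadic scale between the diameter and four times the diameter serves; `κ` pays for empty sets
and single points, which have no such scale. -/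
theorem exists_cell_of_subset {A : Set ℝ} (hA : A ⊆ Set.Icc (1 / 4) (1 / 2)) {s : ℝ} (hs : 0 < s)
    (hs1 : s < 1) {κ : ℝ} (hκ : 0 < κ) :
    ∃ j : ℕ, ∃ i ∈ Icc (0 : ℤ) (2 ^ j), A ⊆ cell ((1 / 2) ^ j) i ∧
      ENNReal.ofReal (((1 / 2 : ℝ) ^ j) ^ s) ≤
        4 * (⨆ _ : A.Nonempty, Metric.ediam A ^ s) + ENNReal.ofReal κ := by
  have hsmall : ∃ j : ℕ, ((1 / 2 : ℝ) ^ j) ^ s ≤ κ := by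
    have h1 : (1 / 2 : ℝ) ^ s < 1 := Real.rpow_lt_one (by norm_num) (by norm_num) hs
    obtain ⟨j, hj⟩ := exists_pow_lt_of_lt_one hκ h1
    exact ⟨j, by rw [← Real.rpow_pow_comm (by norm_num)]; exact hj.le⟩
  rcases A.eq_empty_or_nonempty with rfl | hne
  · obtain ⟨j, hj⟩ := hsmall
    exact ⟨j, 0, by simp, Set.empty_subset _,
      (ENNReal.ofReal_le_ofReal hj).trans le_add_self⟩
  have hb : Bornology.IsBounded A := (Metric.isBounded_Icc _ _).subset hA
  set d := Metric.diam A with hd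
  have hd0 : 0 ≤ d := Metric.diam_nonneg
  have hd1 : d ≤ 1 / 4 := by
    have := Metric.diam_mono hA (Metric.isBounded_Icc _ _)
    rw [Real.diam_Icc (by norm_num)] at this
    linarith
  have hed : Metric.ediam A = ENNReal.ofReal d := by
    rw [hd, Metric.diam, ENNReal.ofReal_toReal hb.ediam_ne_top]
  obtain ⟨j, hj1, hj2⟩ : ∃ j : ℕ, d < (1 / 2 : ℝ) ^ j ∧ ((1 / 2 : ℝ) ^ j) ^ s ≤ 4 * d ^ s + κ := by
    rcases hd0.eq_or_lt with h0 | h0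
    · obtain ⟨j, hj⟩ := hsmall
      refine ⟨j, by rw [← h0]; positivity, hj.trans ?_⟩
      have : 0 ≤ d ^ s := by positivity
      linarith
    · obtain ⟨j, hj1, hj2⟩ := exists_nat_pow_near_of_lt_one (x := 2 * d) (y := (1 / 2 : ℝ))
        (by positivity) (by linarith) (by norm_num) (by norm_num)
      refine ⟨j, by linarith, ?_⟩
      have h4 : (1 / 2 : ℝ) ^ j ≤ 4 * d := by rw [pow_succ] at hj1; linarith
      calc _ ≤ (4 * d) ^ s := by gcongr
        _ = (4 : ℝ) ^ s * d ^ s := Real.mul_rpow (by norm_num) hd0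
        _ ≤ (4 : ℝ) ^ (1 : ℝ) * d ^ s := by gcongr; norm_num
        _ ≤ _ := by rw [Real.rpow_one]; linarith
  set h : ℝ := (1 / 2) ^ j with hh
  have hh0 : 0 < h := by positivity
  set x := sInf A with hx
  have hbb : BddBelow A := ⟨1 / 4, fun y hy => (hA hy).1⟩
  have hx1 : 1 / 4 ≤ x := le_csInf hne fun y hy => (hA hy).1
  have hx2 : x ≤ 1 / 2 := by
    obtain ⟨y, hy⟩ := hne
    exact (csInf_le hbb hy).trans (hA hy).2
  have hceil1 := Int.le_ceil (x / h)
  have hceil2 := Int.ceil_lt_add_one (x / h)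
  rw [div_le_iff₀ hh0] at hceil1
  -- Subtracting 1 from the ceiling puts the left end of the open cell strictly below the infimum,
  -- even when `x / h` is an integer.
  refine ⟨j, ⌈x / h⌉ - 1, ?_, ?_, ?_⟩
  · rw [mem_Icc]
    have h0 : 0 < ⌈x / h⌉ := Int.ceil_pos.2 (by positivity)
    have h1 : ⌈x / h⌉ ≤ 2 ^ j := by
      rw [Int.ceil_le, div_le_iff₀ hh0]
      have : (2 : ℝ) ^ j * h = 1 := by rw [hh, ← mul_pow]; norm_num
      push_cast
      rw [this]; linarith
    omega
  · intro y hy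
    have hyx : x ≤ y := csInf_le hbb hy
    have hyd : y - d ≤ x := le_csInf hne fun z hz => by
      have := Metric.dist_le_diam_of_mem hb hy hz
      rw [Real.dist_eq] at this
      linarith [le_abs_self (y - z)]
    have hlt : ((⌈x / h⌉ : ℤ) - 1 : ℝ) * h < x := by
      rw [← lt_div_iff₀ hh0]; linarith
    simp only [cell, Set.mem_Ioo]
    push_cast
    constructor
    · linarith
    · nlinarith
  · rw [ciSup_pos hne, hed, ENNReal.ofReal_rpow_of_nonneg hd0 hs.le]
    refine (ENNReal.ofReal_le_ofReal hj2).trans ?_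
    rw [ENNReal.ofReal_add (by positivity) hκ.le, ENNReal.ofReal_mul (by norm_num)]
    simp

/-- Cauchy–Schwarz with weights `h ^ (-s)` and `h ^ s` on the covering cells. Keeping `T` a set of
(scale, index) pairs makes its energy part of the full energy. -/
theorem integral_sq_le_energy_mul {s B κ : ℝ} {g : ℝ → ℝ} (hg : Integrable g) (hg0 : ∀ x, 0 ≤ g x)
    (hB : ∀ k, ∑ j ∈ range k, scaleEnergy s g j ≤ B)
    (T : Finset (Σ _ : ℕ, ℤ)) (hT : ∀ p ∈ T, p.2 ∈ Icc (0 : ℤ) (2 ^ p.1))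
    (hcov : ∀ x, g x ≠ 0 → ∃ p ∈ T, x ∈ cell ((1 / 2) ^ p.1) p.2)
    (hκ : ∑ p ∈ T, ((1 / 2 : ℝ) ^ p.1) ^ s ≤ κ) : (∫ x, g x) ^ 2 ≤ B * κ := by
  have h1 : ∫ x, g x ≤ ∑ p ∈ T, ∫ x in cell ((1 / 2) ^ p.1) p.2, g x := by
    simp_rw [← integral_indicator (measurableSet_cell _ _)]
    rw [← integral_finsetSum _ fun p _ => hg.indicator (measurableSet_cell _ _)]
    refine integral_mono hg
      (integrable_finsetSum _ fun p _ => hg.indicator (measurableSet_cell _ _)) fun x => ?_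
    have hnn : ∀ p ∈ T, 0 ≤ (cell ((1 / 2) ^ p.1) p.2).indicator g x :=
      fun p _ => Set.indicator_nonneg (fun y _ => hg0 y) x
    by_cases hx : g x = 0
    · rw [hx]; exact sum_nonneg hnn
    · obtain ⟨p, hp, hxp⟩ := hcov x hx
      calc g x = (cell ((1 / 2) ^ p.1) p.2).indicator g x := (Set.indicator_of_mem hxp g).symm
        _ ≤ _ := single_le_sum (f := fun p : Σ _ : ℕ, ℤ =>
          (cell ((1 / 2) ^ p.1) p.2).indicator g x) hnn hp
  have hI0 : 0 ≤ ∫ x, g x := integral_nonneg hg0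
  obtain ⟨k, hk⟩ : ∃ k, ∀ p ∈ T, p.1 < k :=
    ⟨T.sup Sigma.fst + 1, fun p hp => Nat.lt_succ_of_le (le_sup (f := Sigma.fst) hp)⟩
  have h2 : ∑ p ∈ T, ((1 / 2 : ℝ) ^ p.1) ^ (-s) * (∫ x in cell ((1 / 2) ^ p.1) p.2, g x) ^ 2 ≤
      B := by
    refine le_trans ?_ (hB k)
    unfold scaleEnergy
    simp_rw [mul_sum]
    rw [← sum_sigma (range k) (fun j => Icc (0 : ℤ) (2 ^ j)) fun p : Σ _ : ℕ, ℤ =>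
      ((1 / 2 : ℝ) ^ p.1) ^ (-s) * (∫ x in cell ((1 / 2) ^ p.1) p.2, g x) ^ 2]
    refine sum_le_sum_of_subset_of_nonneg (fun p hp => ?_) fun _ _ _ => by positivity
    exact mem_sigma.2 ⟨mem_range.2 (hk p hp), hT p hp⟩
  calc (∫ x, g x) ^ 2 ≤ (∑ p ∈ T, ∫ x in cell ((1 / 2) ^ p.1) p.2, g x) ^ 2 := by gcongr
    _ ≤ (∑ p ∈ T, ((1 / 2 : ℝ) ^ p.1) ^ (-s) * (∫ x in cell ((1 / 2) ^ p.1) p.2, g x) ^ 2) *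
        ∑ p ∈ T, ((1 / 2 : ℝ) ^ p.1) ^ s := by
        refine sum_sq_le_sum_mul_sum_of_sq_le_mul _ (fun _ _ => by positivity)
          (fun _ _ => by positivity) fun p _ => le_of_eq ?_
        have hpos : (0 : ℝ) < (1 / 2) ^ p.1 := by positivity
        rw [mul_right_comm, ← Real.rpow_add hpos, neg_add_cancel, Real.rpow_zero, one_mul]
    _ ≤ B * κ := by
        have hB0 : 0 ≤ B := by simpa using hB 0
        gcongr

/-- A null limit set has a cheap cover by open cells. Compactness makes finitely many of them cover
some `C k`, so `g k` would have too little mass. -/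
theorem hausdorffMeasure_iInter_ne_zero {s B b : ℝ} (hs0 : 0 < s) (hs1 : s < 1) (hb : 0 < b)
    {g : ℕ → ℝ → ℝ} {C : ℕ → Set ℝ} (hg : ∀ k, Integrable (g k)) (hg0 : ∀ k x, 0 ≤ g k x)
    (hB : ∀ k n, ∑ j ∈ range n, scaleEnergy s (g k) j ≤ B) (hmass : ∀ k, b ≤ ∫ x, g k x)
    (hC : ∀ k, IsCompact (C k)) (hanti : Antitone C) (hsupp : ∀ k, ∀ x ∉ C k, g k x = 0)
    (hC0 : C 0 ⊆ Set.Icc (1 / 4) (1 / 2)) :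
    Measure.hausdorffMeasure s (⋂ k, C k) ≠ 0 := by
  intro hzero
  have hB0 : 0 ≤ B := by simpa using hB 0 0
  obtain ⟨κ, hκ0, hκ⟩ : ∃ κ : ℝ, 0 < κ ∧ B * (6 * κ) < b ^ 2 := by
    refine ⟨b ^ 2 / (12 * (B + 1)), by positivity, ?_⟩
    rw [← sub_pos]
    have : b ^ 2 - B * (6 * (b ^ 2 / (12 * (B + 1)))) = b ^ 2 * (B + 2) / (2 * (B + 1)) := by
      field_simp; ring
    rw [this]; positivity
  obtain ⟨t, ht, htsum⟩ : ∃ t : ℕ → Set ℝ, (⋂ k, C k) ⊆ ⋃ n, t n ∧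
      ∑' n, ⨆ _ : (t n).Nonempty, Metric.ediam (t n) ^ s < ENNReal.ofReal κ := by
    rw [Measure.hausdorffMeasure_apply] at hzero
    -- Any mesh bound would do, since the energy controls all scales; 1 is taken.
    have h1 := le_of_le_of_eq (le_iSup₂ (f := fun (r : ℝ≥0∞) (_ : 0 < r) =>
      ⨅ (t : ℕ → Set ℝ) (_ : (⋂ k, C k) ⊆ ⋃ n, t n) (_ : ∀ n, Metric.ediam (t n) ≤ r),
          ∑' n, ⨆ _ : (t n).Nonempty, Metric.ediam (t n) ^ s) 1 one_pos) hzero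
    have h2 := lt_of_le_of_lt h1 (ENNReal.ofReal_pos.2 hκ0)
    simp only [iInf_lt_iff] at h2
    obtain ⟨t, ht, _, h⟩ := h2
    exact ⟨t, ht, h⟩
  set A : ℕ → Set ℝ := fun n => t n ∩ ⋂ k, C k with hA
  have hAsub : ∀ n, A n ⊆ Set.Icc (1 / 4) (1 / 2) := fun n x hx =>
    hC0 (Set.mem_iInter.1 hx.2 0)
  have hAsum : ∑' n, ⨆ _ : (A n).Nonempty, Metric.ediam (A n) ^ s < ENNReal.ofReal κ := by
    refine lt_of_le_of_lt (ENNReal.tsum_le_tsum fun n => iSup_le fun hne => ?_) htsum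
    rw [ciSup_pos (hne.mono Set.inter_subset_left)]
    exact ENNReal.rpow_le_rpow (Metric.ediam_mono Set.inter_subset_left) hs0.le
  choose j i hi hcell hjs using fun n =>
    exists_cell_of_subset (hAsub n) hs0 hs1 (κ := κ * (1 / 2) ^ n) (by positivity)
  set U : ℕ → Set ℝ := fun n => cell ((1 / 2) ^ j n) (i n) with hU
  have hUo : ∀ n, IsOpen (U n) := fun n => isOpen_Ioo
  have hcov : (⋂ k, C k) ⊆ ⋃ n, U n := fun x hx => by
    obtain ⟨n, hn⟩ := Set.mem_iUnion.1 (ht hx)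
    exact Set.mem_iUnion.2 ⟨n, hcell n ⟨hn, hx⟩⟩
  obtain ⟨k, hk⟩ : ∃ k, C k ⊆ ⋃ n, U n :=
    exists_subset_nhds_of_isCompact hanti.directed_ge hC
      fun x hx => (isOpen_iUnion hUo).mem_nhds (hcov hx)
  obtain ⟨F, hF⟩ := (hC k).elim_finite_subcover U hUo hk
  classical
  set T : Finset (Σ _ : ℕ, ℤ) := F.image fun n => ⟨j n, i n⟩ with hT
  have hTsum : ∑ p ∈ T, ((1 / 2 : ℝ) ^ p.1) ^ s ≤ 6 * κ := by
    calc _ ≤ ∑ n ∈ F, ((1 / 2 : ℝ) ^ j n) ^ s :=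
          sum_image_le_of_nonneg fun _ _ => by positivity
      _ ≤ 6 * κ := by
        rw [← ENNReal.ofReal_le_ofReal_iff (by positivity),
          ENNReal.ofReal_sum_of_nonneg fun _ _ => by positivity]
        calc _ ≤ ∑ n ∈ F, (4 * (⨆ _ : (A n).Nonempty, Metric.ediam (A n) ^ s) +
              ENNReal.ofReal (κ * (1 / 2) ^ n)) := sum_le_sum fun n _ => hjs n
          _ = 4 * ∑ n ∈ F, (⨆ _ : (A n).Nonempty, Metric.ediam (A n) ^ s) +
              ENNReal.ofReal (∑ n ∈ F, κ * (1 / 2) ^ n) := by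
              rw [sum_add_distrib, ← mul_sum,
                ENNReal.ofReal_sum_of_nonneg fun _ _ => by positivity]
          _ ≤ 4 * ENNReal.ofReal κ + ENNReal.ofReal (2 * κ) := by
              gcongr
              · exact (ENNReal.sum_le_tsum F).trans hAsum.le
              · rw [← mul_sum, mul_comm 2 κ]
                gcongr
                exact sum_one_half_pow_le_two F
          _ = ENNReal.ofReal (6 * κ) := by
              rw [show (4 : ℝ≥0∞) = ENNReal.ofReal 4 by simp, ← ENNReal.ofReal_mul (by norm_num),
                ← ENNReal.ofReal_add (by positivity) (by positivity)]
              congr 1; ring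
  have hfin := integral_sq_le_energy_mul (hg k) (hg0 k) (hB k) T
    (by
      intro p hp
      obtain ⟨n, _, rfl⟩ := mem_image.1 hp
      exact hi n)
    (by
      intro x hx
      have hxC : x ∈ C k := by_contra fun hn => hx (hsupp k x hn)
      obtain ⟨n, hn, hxn⟩ := Set.mem_iUnion₂.1 (hF hxC)
      exact ⟨_, mem_image_of_mem _ hn, hxn⟩) hTsum
  have : b ^ 2 ≤ (∫ x, g k x) ^ 2 := by gcongr; exact hmass k
  linarith

/-! ### The iterated construction -/

/-- A stage of the construction: a step density, and a compact set outside which it vanishes. -/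
structure Stage where
  /-- The density. -/
  density : ℝ → ℝ
  /-- The compact set carrying the density. -/
  carrier : Set ℝ
  isStep : IsStep density
  nonneg : ∀ x, 0 ≤ density x
  isCompact : IsCompact carrier
  subset : carrier ⊆ Set.Icc (1 / 4) (1 / 2)
  eq_zero : ∀ x ∉ carrier, density x = 0

theorem Stage.exists_next {ψ : ℕ → ℝ} (hψ : ∀ n : ℕ, 1 ≤ n → 0 ≤ ψ n)
    (hdiv : ∀ ε : ℝ, 0 < ε → ε < 1 →
      ¬ Summable (fun n : ℕ => (ψ n / (n : ℝ)) ^ (1 - ε) * (Nat.totient n : ℝ)))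
    {s : ℝ} (hs0 : 0 < s) (hs1 : s < 1) (S : Stage) {ε : ℝ} (hε : 0 < ε) (m : ℕ) :
    ∃ S' : Stage, S'.carrier ⊆ S.carrier ∧
      (∀ x ∈ S'.carrier, ∃ n ≥ m, (x : UnitAddCircle) ∈ E ψ n) ∧
      (∫ x, S.density x) - ε ≤ ∫ x, S'.density x ∧
      ∀ B : ℝ, (∀ k, ∑ j ∈ range k, scaleEnergy s S.density j ≤ B) →
        ∀ k, ∑ j ∈ range k, scaleEnergy s S'.density j ≤ B + ε := by
  obtain ⟨g', h1, h2, h3, ⟨K, hK, hKE, hKg⟩, h5, h6⟩ := exists_refinement hψ hdiv hs0 hs1 S.isStep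
    S.nonneg (fun x hx => S.eq_zero x fun hxc => hx
      ⟨by linarith [(S.subset hxc).1], by linarith [(S.subset hxc).2]⟩) hε m
  refine ⟨⟨g', S.carrier ∩ K, h1, h2, S.isCompact.inter_right hK,
    Set.inter_subset_left.trans S.subset, fun x hx => ?_⟩, Set.inter_subset_left,
    fun x hx => hKE x hx.2, h5, h6⟩
  by_cases hxc : x ∈ S.carrier
  · exact hKg x fun hxK => hx ⟨hxc, hxK⟩
  · exact h3 x (S.eq_zero x hxc)

/-- The errors `1/16 * (1/2) ^ k` total at most `1/8`, half the initial mass `1/4`. Carrier `k + 1`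
only meets points lying in some `E ψ n` with `n ≥ k`, so the intersection projects into the limsup
set. -/
theorem exists_compact_hausdorffMeasure_ne_zero {ψ : ℕ → ℝ} (hψ : ∀ n : ℕ, 1 ≤ n → 0 ≤ ψ n)
    (hdiv : ∀ ε : ℝ, 0 < ε → ε < 1 →
      ¬ Summable (fun n : ℕ => (ψ n / (n : ℝ)) ^ (1 - ε) * (Nat.totient n : ℝ)))
    {s : ℝ} (hs0 : 0 < s) (hs1 : s < 1) :
    ∃ C : Set ℝ, C ⊆ Set.Icc (1 / 4) (1 / 2) ∧ (∀ x ∈ C, (x : UnitAddCircle) ∈ W ψ) ∧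
      Measure.hausdorffMeasure s C ≠ 0 := by
  have hε : ∀ k : ℕ, (0 : ℝ) < 1 / 16 * (1 / 2) ^ k := fun k => by positivity
  choose next hsub hE hmass henergy using fun (S : Stage) (k : ℕ) =>
    Stage.exists_next hψ hdiv hs0 hs1 S (hε k) k
  let S₀ : Stage :=
    { density := (Set.Icc (1 / 4) (1 / 2)).indicator 1
      carrier := Set.Icc (1 / 4) (1 / 2)
      isStep := isStep_indicator_Icc _ _
      nonneg := fun x => Set.indicator_nonneg (fun _ _ => zero_le_one) x
      isCompact := isCompact_Icc
      subset := le_rfl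
      eq_zero := fun x hx => Set.indicator_of_notMem hx _ }
  let S : ℕ → Stage := fun k => Nat.rec S₀ (fun k T => next T k) k
  have hS : ∀ k, S (k + 1) = next (S k) k := fun _ => rfl
  have hgeo : ∀ k, ∑ l ∈ range k, (1 / 16 : ℝ) * (1 / 2) ^ l ≤ 1 / 8 := fun k => by
    rw [← mul_sum]
    linarith [sum_one_half_pow_le_two (range k)]
  have hm : ∀ k, 1 / 4 - ∑ l ∈ range k, (1 / 16 : ℝ) * (1 / 2) ^ l ≤ ∫ x, (S k).density x := by
    intro k
    induction k with
    | zero =>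
      change _ ≤ ∫ x, (Set.Icc (1 / 4 : ℝ) (1 / 2)).indicator (1 : ℝ → ℝ) x
      rw [integral_indicator_one measurableSet_Icc, Real.volume_real_Icc_of_le (by norm_num)]
      norm_num
    | succ k ih =>
      rw [sum_range_succ, hS]
      linarith [hmass (S k) k]
  set B₀ := 8 * (1 - (1 / 2 : ℝ) ^ (1 - s))⁻¹ with hB₀
  have hen : ∀ k n, ∑ j ∈ range n, scaleEnergy s (S k).density j ≤
      B₀ + ∑ l ∈ range k, (1 / 16 : ℝ) * (1 / 2) ^ l := by
    intro k
    induction k with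
    | zero =>
      intro n
      rw [range_zero, sum_empty, add_zero]
      exact sum_scaleEnergy_indicator_le hs1 n
    | succ k ih =>
      intro n
      rw [sum_range_succ, ← add_assoc, hS]
      exact henergy (S k) k _ ih n
  refine ⟨⋂ k, (S k).carrier, Set.iInter_subset_of_subset 0 (S 0).subset, fun x hx => ?_, ?_⟩
  · rw [W, mem_limsup_iff_frequently_mem, frequently_atTop]
    intro k
    exact hE (S k) k x (Set.mem_iInter.1 hx (k + 1))
  · exact hausdorffMeasure_iInter_ne_zero (B := B₀ + 1 / 8) (b := 1 / 8) hs0 hs1 (by norm_num)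
      (fun k => (S k).isStep.integrable) (fun k => (S k).nonneg)
      (fun k n => (hen k n).trans (by linarith [hgeo k])) (fun k => by linarith [hm k, hgeo k])
      (fun k => (S k).isCompact) (antitone_nat_of_succ_le fun k => hsub (S k) k)
      (fun k => (S k).eq_zero) (S 0).subset

/-! ### Passage to the circle -/

/-- Differences in `[1/4, 1/2]` stay below `1/2` in absolute value, so the quotient map is isometric
there. -/
theorem dimH_le_dimH_coe_image {C : Set ℝ} (hC : C ⊆ Set.Icc (1 / 4) (1 / 2)) :
    dimH C ≤ dimH ((fun x : ℝ => (x : UnitAddCircle)) '' C) := by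
  have hiso : Isometry fun x : C => ((x : ℝ) : UnitAddCircle) := by
    refine Isometry.of_dist_eq fun x y => ?_
    have hx := hC x.2
    have hy := hC y.2
    rw [dist_eq_norm, ← AddCircle.coe_sub, UnitAddCircle.norm_eq, Subtype.dist_eq, Real.dist_eq]
    have hr : round ((x : ℝ) - y) = 0 := by
      rw [round_eq_zero_iff]
      constructor <;> linarith [hx.1, hx.2, hy.1, hy.2]
    rw [hr]; simp
  have h1 := hiso.dimH_image Set.univ
  have h2 := (isometry_subtype_coe (s := C)).dimH_image Set.univ
  rw [Set.image_univ, Subtype.range_coe] at h2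
  rw [h2, ← h1, Set.image_univ]
  refine dimH_mono ?_
  rintro _ ⟨x, rfl⟩
  exact ⟨x, x.2, rfl⟩

theorem dimH_unitAddCircle_le_one (A : Set UnitAddCircle) : dimH A ≤ 1 := by
  have hlip : LipschitzWith 1 fun x : ℝ => (x : UnitAddCircle) :=
    LipschitzWith.of_dist_le_mul fun x y => by
      rw [dist_eq_norm, ← AddCircle.coe_sub, UnitAddCircle.norm_eq, NNReal.coe_one, one_mul,
        Real.dist_eq]
      simpa using round_le (x - y : ℝ) 0
  calc dimH A ≤ dimH (Set.range fun x : ℝ => (x : UnitAddCircle)) :=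
        dimH_mono fun x _ => QuotientAddGroup.mk_surjective x
    _ ≤ dimH (Set.univ : Set ℝ) := hlip.dimH_range_le
    _ = 1 := Real.dimH_univ

end DuffinSchaeffer

theorem theorem2 (ψ : ℕ → ℝ) (hψ : ∀ n : ℕ, 1 ≤ n → 0 ≤ ψ n)
    (hdiv : ∀ ε : ℝ, 0 < ε → ε < 1 →
      ¬ Summable (fun n : ℕ => (ψ n / (n : ℝ)) ^ (1 - ε) * (Nat.totient n : ℝ))) :
    dimH (DuffinSchaeffer.W ψ) = 1 := by
  refine le_antisymm (DuffinSchaeffer.dimH_unitAddCircle_le_one _)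
    (ENNReal.le_of_forall_nnreal_lt fun s hs => ?_)
  have hs1 : s < 1 := by exact_mod_cast hs
  rcases eq_or_ne s 0 with rfl | hs0
  · simp
  obtain ⟨C, hC, hCW, hpos⟩ := DuffinSchaeffer.exists_compact_hausdorffMeasure_ne_zero hψ hdiv
    (s := s) (NNReal.coe_pos.2 (pos_iff_ne_zero.2 hs0)) (by exact_mod_cast hs1)
  calc (s : ENNReal) ≤ dimH C := le_dimH_of_hausdorffMeasure_ne_zero hpos
    _ ≤ _ := DuffinSchaeffer.dimH_le_dimH_coe_image hC
    _ ≤ _ := dimH_mono (by rintro _ ⟨x, hx, rfl⟩; exact hCW x hx)
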